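/- A weighted graph $(E,\omega)$ consists of countable sets $E^0$ (vertices) and $E^{\mathrm{st}}$ (structured edges), source and range maps $s,r:E^{\mathrm{st}}\to E^0$ and a weight map $\omega:E^{\mathrm{st}}\to\{1,2,3,\dots\}$; each $\alpha\in E^{\mathrm{st}}$ gives distinct edges $\alpha_1,\dots,\alpha_{\omega(\alpha)}$, and $E^1$ is the set of all of these. All weighted graphs are assumed to be row-finite, i.e. $s^{-1}(v)$ is finite for every $v\in E^0$. For $v\in E^0$ that is not a sink (i.e. $s^{-1}(v)\neq\emptyset$) put $\omega(v)=\max\{\omega(\alpha)\mid \alpha\in s^{-1}(v)\}$. Let $R$ be a unital, not necessarily commutative ring. Let $X=E^0\cup E^1\cup\{\alpha_i^*\mid\alpha_i\in E^1\}$ (a disjoint union), and let $R\langle X\rangle$ be the free left $R$-module on the nonempty words over $X$, with the multiplication $(\sum_x r_x x)(\sum_y s_y y)=\sum_{x,y} r_xs_y\,xy$. The weighted Leavitt path algebra $L_R(E,\omega)$ is the quotient of the (non-unital) ring $R\langle X\rangle$ by the two-sided ideal and $R$-subbimodule generated by the relations 1. $vw=\delta_{vw}v$ for all $v,w\in E^0$;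 2. $s(\alpha)\alpha_i=\alpha_i=\alpha_i r(\alpha)$ and $r(\alpha)\alpha_i^*=\alpha_i^*=\alpha_i^*s(\alpha)$ for all $\alpha\in E^{\mathrm{st}}$, $1\le i\le\omega(\alpha)$; 3. $\sum_{\alpha\in s^{-1}(v)}\alpha_i\alpha_j^*=\delta_{ij}v$ for all $v\in E^0$ that are not sinks and all $1\le i,j\le\omega(v)$; 4. $\sum_{1\le i\le\max\{\omega(\alpha),\omega(\beta)\}}\alpha_i^*\beta_i=\delta_{\alpha\beta}r(\alpha)$ for all $\alpha,\beta\in E^{\mathrm{st}}$, where in (3) and (4) $\alpha_i$ and $\alpha_i^*$ are read as $0$ if $i>\omega(\alpha)$. Call $(E,\omega)$ an LV-graph if $E^{\mathrm{st}}\neq\emptyset$; $(E,\omega)$ is connected (any two vertices are joined by a path that may traverse edges in either direction); $\omega(\alpha)\ge 2$ for all $\alpha\in E^{\mathrm{st}}$; and for every $v\in E^0$ that is not a sink at least two $\alpha\in s^{-1}(v)$ satisfy $\omega(\alpha)=\omega(v)$. A not necessarily unital ring $A$ is called right nonsingular if the only $a\in A$ whose right annihilator $\{b\in A\mid ab=0\}$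 is an essential right ideal (one that has nonzero intersection with every nonzero right ideal of $A$) is $a=0$. Left nonsingular is defined symmetrically, with left annihilators $\{b\in A\mid ba=0\}$ and left ideals. **Theorem.** If $(E,\omega)$ is an LV-graph and $R$ is a (not necessarily commutative) domain, i.e. a nonzero unital ring without zero divisors, then $L_R(E,\omega)$ is left and right nonsingular. -/

import Mathlib

open scoped MonoidAlgebra

/-- A row-finite weighted graph with vertex set `V` and set of structured edges `E`: source and
range maps, a weight map with positive values, and only finitely many structured edges starting
at each vertex. The edges are the pairs `(α, i)` with `i : Fin (weight α)`; thus the edges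
`α₁, …, α_{ω(α)}` are numbered here from `0` to `ω(α) - 1`. -/
structure WeightedGraph (V E : Type*) where
  src : E → V
  rng : E → V
  weight : E → ℕ
  weight_pos : ∀ α, 0 < weight α
  rowFinite : ∀ v, {α | src α = v}.Finite

namespace WeightedGraph

universe u v w

variable {V : Type u} {E : Type v} (G : WeightedGraph V E)

/-- The alphabet `X = E⁰ ∪ E¹ ∪ (E¹)*`. -/
inductive Letter : Type (max u v)
  | vertex (x : V) : Letter
  | edge (α : E) (i : Fin (G.weight α)) : Letter
  | ghost (α : E) (i : Fin (G.weight α)) : Letter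

/-- The source of a letter, as used for generalised paths. -/
def Letter.source {G : WeightedGraph V E} : G.Letter → V
  | .vertex x => x
  | .edge α _ => G.src α
  | .ghost α _ => G.rng α

/-- The range of a letter, as used for generalised paths. -/
def Letter.range {G : WeightedGraph V E} : G.Letter → V
  | .vertex x => x
  | .edge α _ => G.rng α
  | .ghost α _ => G.src α

/-- There is a generalised path from `x` to `y`: a chain of consecutive edges and ghost edges
(letters that are vertices only add trivial steps). -/
def Linked (x y : V) : Prop :=
  Relation.ReflTransGen (fun a b => ∃ l : G.Letter, l.source = a ∧ l.range = b) x y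

/-- The graph is connected: there is exactly one connected component. -/
def Connected : Prop := Nonempty V ∧ ∀ x y : V, G.Linked x y

/-- The finite set `s⁻¹(x)` of structured edges starting at `x`. -/
noncomputable def out (x : V) : Finset E := (G.rowFinite x).toFinset

/-- `ω(x)`, the maximal weight of a structured edge starting at `x` (it is `0` if `x` is a sink,
where it is not used). -/
noncomputable def maxWeight (x : V) : ℕ := (G.out x).sup G.weight

/-- LV-graphs: connected weighted graphs with at least one structured edge, such that all weights
are at least `2` and every vertex that is not a sink emits at least two structured edges of
maximal weight. -/
structure IsLV : Prop where
  nonempty : Nonempty E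
  connected : G.Connected
  two_le_weight : ∀ α, 2 ≤ G.weight α
  two_le_card : ∀ x, (G.out x).Nonempty →
    2 ≤ ((G.out x).filter fun α => G.weight α = G.maxWeight x).card

section Algebra

variable (R : Type w) [Ring R]

/-- The free `R`-ring `R⟨X⟩`: the free left `R`-module on the nonempty words over `X`, with
`(∑ rₓ x)(∑ s_y y) = ∑ rₓ s_y xy`. It is not unital. -/
abbrev FreeRing : Type (max u v w) := MonoidAlgebra R (FreeSemigroup G.Letter)

/-- The generator of the free `R`-ring given by a letter. -/
noncomputable def gen (l : G.Letter) : G.FreeRing R := MonoidAlgebra.single (FreeSemigroup.of l) 1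

/-- The vertex `x` in the free `R`-ring. -/
noncomputable def vtx (x : V) : G.FreeRing R := G.gen R (.vertex x)

/-- The edge `αᵢ` in the free `R`-ring, which is zero if `i` is out of range. -/
noncomputable def edg (α : E) (i : ℕ) : G.FreeRing R :=
  if h : i < G.weight α then G.gen R (.edge α ⟨i, h⟩) else 0

/-- The ghost edge `αᵢ*` in the free `R`-ring, which is zero if `i` is out of range. -/
noncomputable def gho (α : E) (i : ℕ) : G.FreeRing R :=
  if h : i < G.weight α then G.gen R (.ghost α ⟨i, h⟩) else 0

open Classical in
/-- The defining relations `a = b` of the weighted Leavitt path algebra. -/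
inductive LeavittRel : G.FreeRing R → G.FreeRing R → Prop
  | vertex_mul (x y : V) :
      LeavittRel (G.vtx R x * G.vtx R y) (if x = y then G.vtx R x else 0)
  | src_edge (α : E) (i : ℕ) (hi : i < G.weight α) :
      LeavittRel (G.vtx R (G.src α) * G.edg R α i) (G.edg R α i)
  | edge_rng (α : E) (i : ℕ) (hi : i < G.weight α) :
      LeavittRel (G.edg R α i * G.vtx R (G.rng α)) (G.edg R α i)
  | rng_ghost (α : E) (i : ℕ) (hi : i < G.weight α) :
      LeavittRel (G.vtx R (G.rng α) * G.gho R α i) (G.gho R α i)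
  | ghost_src (α : E) (i : ℕ) (hi : i < G.weight α) :
      LeavittRel (G.gho R α i * G.vtx R (G.src α)) (G.gho R α i)
  | sum_edge_ghost (x : V) (i j : ℕ) (hi : i < G.maxWeight x) (hj : j < G.maxWeight x) :
      LeavittRel (∑ α ∈ G.out x, G.edg R α i * G.gho R α j) (if i = j then G.vtx R x else 0)
  | sum_ghost_edge (α β : E) :
      LeavittRel
        (∑ i ∈ Finset.range (max (G.weight α) (G.weight β)), G.gho R α i * G.edg R β i)
        (if α = β then G.vtx R (G.rng α) else 0)

/-- The ideal of the `R`-ring `R⟨X⟩` (a two-sided ideal that is an `R`-subbimodule) generated by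
the relations. -/
noncomputable def leavittIdeal : TwoSidedIdeal (G.FreeRing R) :=
  sInf {J | (∀ (r : R), ∀ a ∈ J, r • a ∈ J) ∧ (∀ (r : R), ∀ a ∈ J, MulOpposite.op r • a ∈ J) ∧
    ∀ a b, G.LeavittRel R a b → a - b ∈ J}

/-- The weighted Leavitt path algebra `L_R(E, ω)`. -/
abbrev LeavittPathAlgebra : Type (max u v w) := (G.leavittIdeal R).ringCon.Quotient

end Algebra

end WeightedGraph

section Nonsingular

variable {A : Type*} [NonUnitalRing A]

/-- Right ideals of a not necessarily unital ring. -/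
def IsRightIdeal (J : AddSubgroup A) : Prop := ∀ x ∈ J, ∀ a : A, x * a ∈ J

/-- Left ideals of a not necessarily unital ring. -/
def IsLeftIdeal (J : AddSubgroup A) : Prop := ∀ x ∈ J, ∀ a : A, a * x ∈ J

/-- The right annihilator `{b | a * b = 0}`. -/
def rightAnnihilator (a : A) : AddSubgroup A := (AddMonoidHom.mulLeft a).ker

/-- The left annihilator `{b | b * a = 0}`. -/
def leftAnnihilator (a : A) : AddSubgroup A := (AddMonoidHom.mulRight a).ker

/-- Essential right ideals: those that meet every nonzero right ideal nontrivially. -/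
def IsEssentialRightIdeal (I : AddSubgroup A) : Prop :=
  IsRightIdeal I ∧ ∀ J : AddSubgroup A, IsRightIdeal J → J ≠ ⊥ → I ⊓ J ≠ ⊥

/-- Essential left ideals: those that meet every nonzero left ideal nontrivially. -/
def IsEssentialLeftIdeal (I : AddSubgroup A) : Prop :=
  IsLeftIdeal I ∧ ∀ J : AddSubgroup A, IsLeftIdeal J → J ≠ ⊥ → I ⊓ J ≠ ⊥

variable (A)

/-- Right nonsingular: only zero has an essential right annihilator. -/
def IsRightNonsingular : Prop :=
  ∀ a : A, IsEssentialRightIdeal (rightAnnihilator a) → a = 0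

/-- Left nonsingular: only zero has an essential left annihilator. -/
def IsLeftNonsingular : Prop :=
  ∀ a : A, IsEssentialLeftIdeal (leftAnnihilator a) → a = 0

end Nonsingular

/-! The theorem follows from a local absence of zero divisors (`IsLV.mul_ne_zero`): if `x = xv` and
`y = vy` are nonzero for a vertex `v`, then `xy ≠ 0`. Indeed, finite sums of vertices act as local
units, so a nonzero `a` has `av ≠ 0` for some vertex `v`. A nonzero element `vb` of the right ideal
`vA` then satisfies `a(vb) = (av)(vb) ≠ 0`. Hence the right annihilator of `a` misses `vA` and is
not essential. The left-hand case is the mirror image.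

The local statement rests on normal forms. At every vertex that is not a sink select one edge `c` of
maximal weight (`IsSelector`). Solve relation (3) for `cᵢcⱼ*` and relation (4) for `α₀*β₀`, where
indices start at `0`. Words avoiding these two kinds of pairs are normal. Prepending a letter and
rewriting the first pair defines operators on the free left `R`-module on words. On the span of the
normal words ending in a fixed vertex these operators satisfy all defining relations
(`rep_eq_of_leavittRel`), so the algebra acts on that span. Conversely, applying an element to the
empty word yields an expansion of that element in normal words (`toLeavitt_mul_wordSum`).

Nonvanishing of products is then read off in top degree. Each rewriting rule replaces a pair by
minus a sum of normal pairs, its leading part (`Swap`), up to a term shorter by two letters. Let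
`pa` and `bq` be longest words of the two factors `X` and `Y`. For a normal pair `ab`, the
coefficient of `pabq` in the product is `X(pa)Y(bq)`, from which `X(pl)Y(l'q)` is subtracted if `ab`
lies in the leading part of the (unique) pair `ll'`. If the product vanished, products of
coefficients could be transported between a reducible pair and a member of its leading part. The LV
condition makes every leading part nonempty. A mixed pair, with first letter from one of these pairs
and second letter from the other, is normal and in no leading part, so its coefficient is a single
product of nonzero scalars of the domain: a contradiction (`rep_wordSum_ne_zero`). -/

namespace WeightedGraph

universe u v w

/-! ### Words, normal words and selectors -/

/-- The letters of words without vertices: edges and ghost edges, with unrestricted indices. -/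
inductive Step (E : Type v) : Type v
  | real (α : E) (i : ℕ) : Step E
  | ghost (α : E) (i : ℕ) : Step E

variable {V : Type u} {E : Type v} (G : WeightedGraph V E)

/-- The source of a step. -/
def stepSrc : Step E → V
  | .real α _ => G.src α
  | .ghost α _ => G.rng α

/-- The range of a step. -/
def stepRng : Step E → V
  | .real α _ => G.rng α
  | .ghost α _ => G.src α

/-- The index of a step is in range. -/
def StepValid : Step E → Prop
  | .real α i => i < G.weight α
  | .ghost α i => i < G.weight α

/-- The source of a word ending in the vertex `u`. -/
def wordSrc (u : V) : List (Step E) → V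
  | [] => u
  | l :: _ => G.stepSrc l

/-- `sp` selects an edge of maximal weight at each vertex that is not a sink. -/
def IsSelector (sp : V → E) : Prop :=
  ∀ x, (G.out x).Nonempty → G.src (sp x) = x ∧ G.weight (sp x) = G.maxWeight x

/-- The subwords of length two that do not occur in normal words. -/
def Reducible (sp : V → E) : Step E → Step E → Prop
  | .real α _, .ghost β _ => α = β ∧ α = sp (G.src α)
  | .ghost _ i, .real _ j => i = 0 ∧ j = 0
  | _, _ => False

/-- Normal words ending in the vertex `u`. -/
def IsNormal (sp : V → E) (u : V) : List (Step E) → Prop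
  | [] => True
  | l :: w => G.StepValid l ∧ G.stepRng l = G.wordSrc u w ∧
      (∀ l' ∈ w.head?, ¬ G.Reducible sp l l') ∧ IsNormal sp u w

variable {G} in
theorem mem_out {x : V} {α : E} : α ∈ G.out x ↔ G.src α = x := by
  simp [out]

variable {G} in
theorem weight_le_maxWeight (α : E) : G.weight α ≤ G.maxWeight (G.src α) :=
  Finset.le_sup (f := G.weight) (mem_out.2 rfl)

variable {G} in
theorem IsSelector.src {sp : V → E} (h : G.IsSelector sp) (α : E) :
    G.src (sp (G.src α)) = G.src α :=
  (h _ ⟨α, mem_out.2 rfl⟩).1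

variable {G} in
theorem IsSelector.weight {sp : V → E} (h : G.IsSelector sp) (α : E) :
    G.weight (sp (G.src α)) = G.maxWeight (G.src α) :=
  (h _ ⟨α, mem_out.2 rfl⟩).2

/-! ### Operators given by rewriting the first pair of a word -/

section Operators

variable (R : Type w) [Ring R]

open Classical in
/-- The word `γᵢ γⱼ* w`, or zero if an index is out of range. -/
noncomputable def realGhost (γ : E) (i j : ℕ) (w : List (Step E)) : List (Step E) →₀ R :=
  if i < G.weight γ ∧ j < G.weight γ then Finsupp.single (.real γ i :: .ghost γ j :: w) 1 else 0

open Classical in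
/-- The word `αₖ* βₖ w`, or zero if an index is out of range. -/
noncomputable def ghostReal (α β : E) (k : ℕ) (w : List (Step E)) : List (Step E) →₀ R :=
  if k < G.weight α ∧ k < G.weight β then Finsupp.single (.ghost α k :: .real β k :: w) 1 else 0

open Classical in
/-- The normal form of `αᵢ w`. -/
noncomputable def realAct (sp : V → E) (u : V) (α : E) (i : ℕ) (w : List (Step E)) :
    List (Step E) →₀ R :=
  if i < G.weight α ∧ G.rng α = G.wordSrc u w then
    match w with
    | .ghost β j :: w' =>
      if α = β ∧ α = sp (G.src α) then
        (if i = j then Finsupp.single w' 1 else 0) -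
          ∑ γ ∈ (G.out (G.src α)).erase α, G.realGhost R γ i j w'
      else Finsupp.single (.real α i :: .ghost β j :: w') 1
    | w => Finsupp.single (.real α i :: w) 1
  else 0

open Classical in
/-- The normal form of `αᵢ* w`. -/
noncomputable def ghostAct (u : V) (α : E) (i : ℕ) (w : List (Step E)) :
    List (Step E) →₀ R :=
  if i < G.weight α ∧ G.src α = G.wordSrc u w then
    match w with
    | .real β j :: w' =>
      if i = 0 ∧ j = 0 then
        (if α = β then Finsupp.single w' 1 else 0) -
          ∑ k ∈ Finset.Ico 1 (max (G.weight α) (G.weight β)), G.ghostReal R α β k w'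
      else Finsupp.single (.ghost α i :: .real β j :: w') 1
    | w => Finsupp.single (.ghost α i :: w) 1
  else 0

open Classical in
/-- The normal form of `x w` for a vertex `x`. -/
noncomputable def vertexAct (u x : V) (w : List (Step E)) : List (Step E) →₀ R :=
  if G.wordSrc u w = x then Finsupp.single w 1 else 0

variable {R} {sp : V → E} {u : V}

theorem realAct_of_not_reducible {α : E} {i : ℕ} {w : List (Step E)} (hi : i < G.weight α)
    (hw : G.rng α = G.wordSrc u w) (h : ∀ l' ∈ w.head?, ¬ G.Reducible sp (.real α i) l') :
    G.realAct R sp u α i w = Finsupp.single (.real α i :: w) 1 := by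
  rcases w with _ | ⟨_ | _, w⟩ <;> simp_all [realAct, Reducible]

theorem realAct_of_reducible {α : E} {i : ℕ} (j : ℕ) (w : List (Step E)) (hi : i < G.weight α)
    (h : α = sp (G.src α)) [DecidableEq E] :
    G.realAct R sp u α i (.ghost α j :: w) = (if i = j then Finsupp.single w 1 else 0) -
      ∑ γ ∈ (G.out (G.src α)).erase α, G.realGhost R γ i j w := by
  simp only [realAct, wordSrc, stepSrc, hi, ← h]
  simp
  congr!

theorem realAct_of_ne {α : E} {i : ℕ} {w : List (Step E)} (hw : G.rng α ≠ G.wordSrc u w) :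
    G.realAct R sp u α i w = 0 := by
  simp [realAct, hw]

theorem realAct_of_le {α : E} {i : ℕ} {w : List (Step E)} (hi : G.weight α ≤ i) :
    G.realAct R sp u α i w = 0 := by
  simp [realAct, hi]

theorem ghostAct_of_not_reducible {α : E} {i : ℕ} {w : List (Step E)} (hi : i < G.weight α)
    (hw : G.src α = G.wordSrc u w) (h : ∀ l' ∈ w.head?, ¬ G.Reducible sp (.ghost α i) l') :
    G.ghostAct R u α i w = Finsupp.single (.ghost α i :: w) 1 := by
  rcases w with _ | ⟨_ | _, w⟩ <;> simp_all [ghostAct, Reducible]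

theorem ghostAct_of_reducible {α β : E} (w : List (Step E)) (hs : G.src α = G.src β)
    [DecidableEq E] :
    G.ghostAct R u α 0 (.real β 0 :: w) = (if α = β then Finsupp.single w 1 else 0) -
      ∑ k ∈ Finset.Ico 1 (max (G.weight α) (G.weight β)), G.ghostReal R α β k w := by
  simp only [ghostAct, wordSrc, stepSrc, hs, G.weight_pos]
  simp

theorem ghostAct_of_ne {α : E} {i : ℕ} {w : List (Step E)} (hw : G.src α ≠ G.wordSrc u w) :
    G.ghostAct R u α i w = 0 := by
  simp [ghostAct, hw]

theorem ghostAct_of_le {α : E} {i : ℕ} {w : List (Step E)} (hi : G.weight α ≤ i) :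
    G.ghostAct R u α i w = 0 := by
  simp [ghostAct, hi]

/-- The edge–ghost relation on words that need no reduction at their first letter. -/
theorem sum_realAct_ghost (hsp : G.IsSelector sp) {x : V} {i j : ℕ} (hi : i < G.maxWeight x)
    (hj : j < G.maxWeight x) (w : List (Step E)) :
    ∑ α ∈ G.out x, (if j < G.weight α then G.realAct R sp u α i (.ghost α j :: w) else 0) =
      if i = j then Finsupp.single w 1 else 0 := by
  classical
  have hne : (G.out x).Nonempty := by
    by_contra h
    rw [Finset.not_nonempty_iff_eq_empty] at h
    simp [maxWeight, h] at hi
  obtain ⟨hs, hw⟩ := hsp x hne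
  -- The selected edge contributes the right-hand side minus exactly the other summands, none of
  -- which needs rewriting.
  rw [← Finset.add_sum_erase _ _ (mem_out.2 hs), if_pos (hw ▸ hj),
    G.realAct_of_reducible j w (hw ▸ hi) (by rw [hs]), hs, sub_add_eq_add_sub, sub_eq_iff_eq_add]
  congr 1
  refine Finset.sum_congr rfl fun γ hγ => ?_
  obtain ⟨h1, h2⟩ := Finset.mem_erase.1 hγ
  rw [mem_out] at h2
  unfold realGhost
  by_cases hjγ : j < G.weight γ
  · by_cases hiγ : i < G.weight γ
    · rw [if_pos hjγ, if_pos ⟨hiγ, hjγ⟩]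
      refine G.realAct_of_not_reducible hiγ rfl ?_
      simp [Reducible, h2, h1]
    · simp [hjγ, hiγ, G.realAct_of_le (not_lt.1 hiγ)]
  · simp [hjγ]

/-- The ghost–edge relation on words that need no reduction at their first letter. -/
theorem sum_ghostAct_real {α β : E} (hs : G.src α = G.src β) (w : List (Step E))
    [DecidableEq E] :
    ∑ k ∈ Finset.range (max (G.weight α) (G.weight β)),
      (if k < G.weight β then G.ghostAct R u α k (.real β k :: w) else 0) =
      if α = β then Finsupp.single w 1 else 0 := by
  have hpos : 0 < max (G.weight α) (G.weight β) := lt_max_of_lt_left (G.weight_pos α)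
  rw [Finset.range_eq_Ico, Finset.sum_eq_sum_Ico_succ_bot hpos, if_pos (G.weight_pos β),
    G.ghostAct_of_reducible w hs, sub_add_eq_add_sub, sub_eq_iff_eq_add]
  congr 1
  refine Finset.sum_congr rfl fun k hk => ?_
  have hk1 : 1 ≤ k := (Finset.mem_Ico.1 hk).1
  unfold ghostReal
  by_cases hkβ : k < G.weight β
  · by_cases hkα : k < G.weight α
    · rw [if_pos hkβ, if_pos ⟨hkα, hkβ⟩]
      -- Reducibility of a pair starting with a ghost does not involve the selector, so any function
      -- serves here.
      refine G.ghostAct_of_not_reducible (sp := fun _ => α) hkα hs ?_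
      simp [Reducible]; omega
    · simp [hkβ, hkα, G.ghostAct_of_le (not_lt.1 hkα)]
  · simp [hkβ]

variable (R sp u)

/-- The span of the normal words. -/
def normalSpan : Submodule R (List (Step E) →₀ R) :=
  Finsupp.supported R R {w | G.IsNormal sp u w}

/-- The operator of an edge. -/
noncomputable def realOp (α : E) (i : ℕ) : Module.End R (List (Step E) →₀ R) :=
  Finsupp.linearCombination R (G.realAct R sp u α i)

/-- The operator of a ghost edge. -/
noncomputable def ghostOp (α : E) (i : ℕ) : Module.End R (List (Step E) →₀ R) :=
  Finsupp.linearCombination R (G.ghostAct R u α i)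

/-- The operator of a vertex. -/
noncomputable def vertexOp (x : V) : Module.End R (List (Step E) →₀ R) :=
  Finsupp.linearCombination R (G.vertexAct R u x)

variable {R sp u}

@[simp] theorem realOp_single (α : E) (i : ℕ) (w : List (Step E)) :
    G.realOp R sp u α i (Finsupp.single w 1) = G.realAct R sp u α i w := by
  simp [realOp]

@[simp] theorem ghostOp_single (α : E) (i : ℕ) (w : List (Step E)) :
    G.ghostOp R u α i (Finsupp.single w 1) = G.ghostAct R u α i w := by
  simp [ghostOp]

@[simp] theorem vertexOp_single (x : V) (w : List (Step E)) :
    G.vertexOp R u x (Finsupp.single w 1) = G.vertexAct R u x w := by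
  simp [vertexOp]

theorem single_mem_normalSpan {w : List (Step E)} (h : G.IsNormal sp u w) (r : R) :
    Finsupp.single w r ∈ G.normalSpan R sp u :=
  Finsupp.single_mem_supported R r h

/-- Exchanging the edge of a ghost but not its index creates no reducible pair to its right: a ghost
followed by a real step is tested on indices alone. -/
theorem realGhost_mem {α γ : E} {i j : ℕ} {w : List (Step E)}
    (hw : G.IsNormal sp u (.ghost α j :: w)) (hs : G.src γ = G.src α)
    (hγ : γ ≠ sp (G.src γ)) : G.realGhost R γ i j w ∈ G.normalSpan R sp u := by
  unfold realGhost
  split_ifs with h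
  · refine G.single_mem_normalSpan ?_ 1
    obtain ⟨-, h2, h3, h4⟩ := hw
    refine ⟨h.1, rfl, by simp [Reducible, hγ], h.2, hs.trans h2, ?_, h4⟩
    rintro (⟨β, k⟩ | ⟨β, k⟩) hl
    · exact h3 _ hl
    · exact id
  · exact zero_mem _

/-- Dually, a real step followed by a ghost is tested on edges alone, so its index may change
freely. -/
theorem ghostReal_mem {α β : E} {k : ℕ} {w : List (Step E)} (hk : 1 ≤ k)
    (hw : G.IsNormal sp u (.real β 0 :: w)) (hs : G.src α = G.src β) :
    G.ghostReal R α β k w ∈ G.normalSpan R sp u := by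
  unfold ghostReal
  split_ifs with h
  · refine G.single_mem_normalSpan ?_ 1
    obtain ⟨-, h2, h3, h4⟩ := hw
    refine ⟨h.1, hs, by simp [Reducible]; omega, h.2, h2, ?_, h4⟩
    rintro (⟨β, k⟩ | ⟨β, k⟩) hl
    · exact id
    · exact h3 _ hl
  · exact zero_mem _

theorem realAct_mem {α : E} {i : ℕ} {w : List (Step E)}
    (hw : G.IsNormal sp u w) : G.realAct R sp u α i w ∈ G.normalSpan R sp u := by
  classical
  by_cases hi : i < G.weight α
  swap
  · rw [G.realAct_of_le (not_lt.1 hi)]; exact zero_mem _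
  by_cases hs : G.rng α = G.wordSrc u w
  swap
  · rw [G.realAct_of_ne hs]; exact zero_mem _
  by_cases hr : ∀ l' ∈ w.head?, ¬ G.Reducible sp (.real α i) l'
  · rw [G.realAct_of_not_reducible hi hs hr]
    refine G.single_mem_normalSpan ?_ 1
    exact ⟨hi, hs, hr, hw⟩
  push Not at hr
  obtain ⟨l', hl, hr⟩ := hr
  rcases w with _ | ⟨⟨β, j⟩ | ⟨β, j⟩, w⟩
  · simp at hl
  · simp at hl; subst hl; exact hr.elim
  · simp at hl; subst hl
    obtain ⟨rfl, hα⟩ := hr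
    rw [G.realAct_of_reducible j w hi hα]
    refine sub_mem ?_ (sum_mem fun γ hγ => ?_)
    · split_ifs
      · exact G.single_mem_normalSpan hw.2.2.2 1
      · exact zero_mem _
    · obtain ⟨h1, h2⟩ := Finset.mem_erase.1 hγ
      rw [mem_out] at h2
      exact G.realGhost_mem hw h2 (by rwa [h2, ← hα])

theorem ghostAct_mem {α : E} {i : ℕ} {w : List (Step E)}
    (hw : G.IsNormal sp u w) : G.ghostAct R u α i w ∈ G.normalSpan R sp u := by
  classical
  by_cases hi : i < G.weight α
  swap
  · rw [G.ghostAct_of_le (not_lt.1 hi)]; exact zero_mem _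
  by_cases hs : G.src α = G.wordSrc u w
  swap
  · rw [G.ghostAct_of_ne hs]; exact zero_mem _
  by_cases hr : ∀ l' ∈ w.head?, ¬ G.Reducible sp (.ghost α i) l'
  · rw [G.ghostAct_of_not_reducible hi hs hr]
    refine G.single_mem_normalSpan ?_ 1
    exact ⟨hi, hs, hr, hw⟩
  push Not at hr
  obtain ⟨l', hl, hr⟩ := hr
  rcases w with _ | ⟨⟨β, j⟩ | ⟨β, j⟩, w⟩
  · simp at hl
  · simp at hl; subst hl
    obtain ⟨rfl, rfl⟩ := hr
    rw [G.ghostAct_of_reducible w hs]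
    refine sub_mem ?_ (sum_mem fun k hk => ?_)
    · split_ifs
      · exact G.single_mem_normalSpan hw.2.2.2 1
      · exact zero_mem _
    · exact G.ghostReal_mem (Finset.mem_Ico.1 hk).1 hw hs
  · simp at hl; subst hl; exact hr.elim

theorem vertexAct_mem {x : V} {w : List (Step E)}
    (hw : G.IsNormal sp u w) : G.vertexAct R u x w ∈ G.normalSpan R sp u := by
  unfold vertexAct
  split_ifs
  · exact G.single_mem_normalSpan hw 1
  · exact zero_mem _

end Operators

/-! ### The defining relations hold on normal words -/

section Relations

variable {R : Type w} [Ring R] {sp : V → E} {u : V}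

/-- Makes the range of summation independent of `α`, so that sums over `α` and `k` can be
interchanged. -/
theorem sum_ghostReal_max (α β : E) (w : List (Step E)) :
    ∑ k ∈ Finset.Ico 1 (max (G.weight α) (G.weight β)), G.ghostReal R α β k w =
      ∑ k ∈ Finset.Ico 1 (G.weight β), G.ghostReal R α β k w := by
  symm
  refine Finset.sum_subset (Finset.Ico_subset_Ico_right (le_max_right _ _)) fun k hk hk' => ?_
  unfold ghostReal
  rw [if_neg]
  rintro ⟨-, h⟩
  exact hk' (Finset.mem_Ico.2 ⟨(Finset.mem_Ico.1 hk).1, h⟩)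

theorem sum_range_ghostAct_real {α β : E} (hs : G.src α = G.src β) (w : List (Step E))
    [DecidableEq E] {N : ℕ} (hN : max (G.weight α) (G.weight β) ≤ N) :
    ∑ k ∈ Finset.range N,
      (if k < G.weight β then G.ghostAct R u α k (.real β k :: w) else 0) =
      if α = β then Finsupp.single w 1 else 0 := by
  rw [← G.sum_ghostAct_real hs w (u := u)]
  symm
  refine Finset.sum_subset (Finset.range_subset_range.2 hN) fun k _ hk' => ?_
  rw [if_neg]
  intro h
  exact hk' (Finset.mem_range.2 (lt_max_of_lt_right h))

theorem vertexOp_of_supported {x : V} {m : List (Step E) →₀ R}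
    (hm : m ∈ Finsupp.supported R R {w | G.wordSrc u w = x}) : G.vertexOp R u x m = m := by
  rw [vertexOp, Finsupp.linearCombination_apply]
  conv_rhs => rw [← Finsupp.sum_single m]
  refine Finsupp.sum_congr fun w hw => ?_
  have : G.wordSrc u w = x := hm hw
  simp [vertexAct, this]

theorem ghostOp_of_supported {x : V} {α : E} {i : ℕ} {m : List (Step E) →₀ R}
    (hm : m ∈ Finsupp.supported R R {w | G.wordSrc u w = x}) (hx : G.src α ≠ x) :
    G.ghostOp R u α i m = 0 := by
  rw [ghostOp, Finsupp.linearCombination_apply]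
  refine Finset.sum_eq_zero fun w hw => ?_
  have : G.wordSrc u w = x := hm hw
  simp only [G.ghostAct_of_ne (this ▸ hx), smul_zero]

theorem realAct_mem_supported {α : E} {i : ℕ} {w : List (Step E)} (hw : G.IsNormal sp u w) :
    G.realAct R sp u α i w ∈ Finsupp.supported R R {w | G.wordSrc u w = G.src α} := by
  classical
  by_cases hi : i < G.weight α
  swap
  · rw [G.realAct_of_le (not_lt.1 hi)]; exact zero_mem _
  by_cases hs : G.rng α = G.wordSrc u w
  swap
  · rw [G.realAct_of_ne hs]; exact zero_mem _
  by_cases hr : ∀ l' ∈ w.head?, ¬ G.Reducible sp (.real α i) l'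
  · rw [G.realAct_of_not_reducible hi hs hr]
    exact Finsupp.single_mem_supported R 1 rfl
  push Not at hr
  obtain ⟨l', hl, hr⟩ := hr
  rcases w with _ | ⟨⟨β, j⟩ | ⟨β, j⟩, w⟩
  · simp at hl
  · simp at hl; subst hl; exact hr.elim
  · simp at hl; subst hl
    obtain ⟨rfl, hα⟩ := hr
    rw [G.realAct_of_reducible j w hi hα]
    refine sub_mem ?_ (sum_mem fun γ hγ => ?_)
    · split_ifs
      · exact Finsupp.single_mem_supported R 1 hw.2.1.symm
      · exact zero_mem _
    · unfold realGhost
      split_ifs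
      · exact Finsupp.single_mem_supported R 1 (mem_out.1 (Finset.mem_erase.1 hγ).2)
      · exact zero_mem _

theorem ghostAct_mem_supported {α : E} {i : ℕ} {w : List (Step E)} (hw : G.IsNormal sp u w) :
    G.ghostAct R u α i w ∈ Finsupp.supported R R {w | G.wordSrc u w = G.rng α} := by
  classical
  by_cases hi : i < G.weight α
  swap
  · rw [G.ghostAct_of_le (not_lt.1 hi)]; exact zero_mem _
  by_cases hs : G.src α = G.wordSrc u w
  swap
  · rw [G.ghostAct_of_ne hs]; exact zero_mem _
  by_cases hr : ∀ l' ∈ w.head?, ¬ G.Reducible sp (.ghost α i) l'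
  · rw [G.ghostAct_of_not_reducible hi hs hr]
    exact Finsupp.single_mem_supported R 1 rfl
  push Not at hr
  obtain ⟨l', hl, hr⟩ := hr
  rcases w with _ | ⟨⟨β, j⟩ | ⟨β, j⟩, w⟩
  · simp at hl
  · simp at hl; subst hl
    obtain ⟨rfl, rfl⟩ := hr
    rw [G.ghostAct_of_reducible w hs]
    refine sub_mem ?_ (sum_mem fun k hk => ?_)
    · split_ifs with h
      · subst h; exact Finsupp.single_mem_supported R 1 hw.2.1.symm
      · exact zero_mem _
    · unfold ghostReal
      split_ifs
      · exact Finsupp.single_mem_supported R 1 rfl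
      · exact zero_mem _
  · simp at hl; subst hl; exact hr.elim

theorem vertexOp_vertexAct [DecidableEq V] (x y : V) (w : List (Step E)) :
    G.vertexOp R u x (G.vertexAct R u y w) = if x = y then G.vertexAct R u x w else 0 := by
  unfold vertexAct
  by_cases h : G.wordSrc u w = y
  · subst h
    by_cases hx : x = G.wordSrc u w
    · simp [hx, vertexAct]
    · simp [hx, vertexAct, Ne.symm hx]
  · by_cases hx : x = y
    · subst hx; simp [h]
    · simp [h, hx]

theorem realOp_vertexAct (α : E) (i : ℕ) (w : List (Step E)) :
    G.realOp R sp u α i (G.vertexAct R u (G.rng α) w) = G.realAct R sp u α i w := by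
  unfold vertexAct
  split_ifs with h
  · simp
  · rw [G.realAct_of_ne (Ne.symm h), map_zero]

theorem ghostOp_vertexAct (α : E) (i : ℕ) (w : List (Step E)) :
    G.ghostOp R u α i (G.vertexAct R u (G.src α) w) = G.ghostAct R u α i w := by
  unfold vertexAct
  split_ifs with h
  · simp
  · rw [G.ghostAct_of_ne (Ne.symm h), map_zero]

/-- The only delicate case is the overlap `αᵢα₀*β₀`. Expanding `α₀*β₀` and summing over `α` first,
the one-letter relation turns the terms `αᵢαₖ*βₖ` with `k ≥ 1` into `βᵢ` when `1 ≤ i < ω(β)`, which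
cancels the `βᵢ` produced by the shorter term; only `i = 0` survives. -/
theorem sum_realOp_ghostAct (hsp : G.IsSelector sp) {x : V} {i j : ℕ} (hi : i < G.maxWeight x)
    (hj : j < G.maxWeight x) {w : List (Step E)} (hw : G.IsNormal sp u w) :
    ∑ α ∈ G.out x, G.realOp R sp u α i (G.ghostAct R u α j w) =
      if i = j then G.vertexAct R u x w else 0 := by
  classical
  by_cases hx : G.wordSrc u w = x
  swap
  · rw [Finset.sum_eq_zero]
    · simp [vertexAct, hx]
    · intro α hα
      rw [mem_out] at hα
      rw [G.ghostAct_of_ne (by rw [hα]; exact Ne.symm hx), map_zero]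
  rw [vertexAct, if_pos hx]
  by_cases hr : ∀ l' ∈ w.head?, ∀ α, ¬ G.Reducible sp (.ghost α j) l'
  · rw [← G.sum_realAct_ghost hsp hi hj w (u := u)]
    refine Finset.sum_congr rfl fun α hα => ?_
    rw [mem_out] at hα
    split_ifs with h
    · rw [G.ghostAct_of_not_reducible h (hα.trans hx.symm) (fun l' hl => hr l' hl α), realOp_single]
    · rw [G.ghostAct_of_le (not_lt.1 h), map_zero]
  push Not at hr
  obtain ⟨l', hl, α, hr⟩ := hr
  rcases w with _ | ⟨⟨β, l⟩ | ⟨β, l⟩, w⟩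
  · simp at hl
  swap
  · simp at hl; subst hl; exact hr.elim
  simp at hl; subst hl
  obtain ⟨rfl, rfl⟩ := hr
  have hβ : G.src β = x := hx
  have key : ∀ α ∈ G.out x, G.realOp R sp u α i (G.ghostAct R u α 0 (.real β 0 :: w)) =
      (if α = β then G.realAct R sp u α i w else 0) - ∑ k ∈ Finset.Ico 1 (G.weight β),
        (if k < G.weight α then G.realAct R sp u α i (.ghost α k :: .real β k :: w) else 0) := by
    intro α hα
    rw [mem_out] at hα
    rw [G.ghostAct_of_reducible w (hα.trans hβ.symm), sum_ghostReal_max, map_sub, map_sum]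
    congr 1
    · split_ifs <;> simp
    · refine Finset.sum_congr rfl fun k hk => ?_
      unfold ghostReal
      have : k < G.weight β := (Finset.mem_Ico.1 hk).2
      by_cases h : k < G.weight α <;> simp [h, this]
  rw [Finset.sum_congr rfl key, Finset.sum_sub_distrib, Finset.sum_ite_eq', if_pos (mem_out.2 hβ),
    Finset.sum_comm]
  have key2 : ∀ k ∈ Finset.Ico 1 (G.weight β), ∑ α ∈ G.out x,
      (if k < G.weight α then G.realAct R sp u α i (.ghost α k :: .real β k :: w) else 0) =
      if i = k then Finsupp.single (.real β i :: w) 1 else 0 := by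
    intro k hk
    rw [G.sum_realAct_ghost hsp hi ((Finset.mem_Ico.1 hk).2.trans_le
      (hβ ▸ weight_le_maxWeight β))]
    split_ifs with h
    · rw [h]
    · rfl
  rw [Finset.sum_congr rfl key2, Finset.sum_ite_eq]
  by_cases hiβ : i < G.weight β
  -- Normality of the word beginning with `β₀` transfers to `βᵢ`, as the index plays no role in this
  -- test.
  · rw [G.realAct_of_not_reducible hiβ hw.2.1 fun l' hl => by
      have := hw.2.2.1 l' hl
      rcases l' with _ | _ <;> exact this]
    by_cases h0 : i = 0
    · simp [h0]
    · have : 1 ≤ i := by omega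
      simp [h0, hiβ, this]
  · have h0 : i ≠ 0 := by have := G.weight_pos β; omega
    rw [G.realAct_of_le (not_lt.1 hiβ)]
    simp [hiβ, h0]

/-- Here the overlap is `αₖ*βₖβⱼ*` with `β` selected. Expanding `βₖβⱼ*` leaves `αⱼ*` minus the terms
`αₖ*γₖγⱼ*` with `γ ≠ β`; summed over `k` these give `αⱼ*` if `α ≠ β` and nothing otherwise.
Maximality of the weight of `β` makes the range of `k` long enough for every `γ`. -/
theorem sum_ghostOp_realAct [DecidableEq E] (hsp : G.IsSelector sp) (α β : E)
    {w : List (Step E)} (hw : G.IsNormal sp u w) :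
    ∑ k ∈ Finset.range (max (G.weight α) (G.weight β)),
      G.ghostOp R u α k (G.realAct R sp u β k w) =
      if α = β then G.vertexAct R u (G.rng α) w else 0 := by
  by_cases hs : G.src α = G.src β
  swap
  · rw [Finset.sum_eq_zero, if_neg (by rintro rfl; exact hs rfl)]
    intro k _
    exact G.ghostOp_of_supported (G.realAct_mem_supported hw) hs
  by_cases hx : G.rng β = G.wordSrc u w
  swap
  · rw [Finset.sum_eq_zero]
    · split_ifs with h
      · subst h; simp [vertexAct, Ne.symm hx]
      · rfl
    · intro k _
      rw [G.realAct_of_ne hx, map_zero]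
  have hR : (if α = β then G.vertexAct R u (G.rng α) w else 0) =
      if α = β then Finsupp.single w 1 else 0 := by
    split_ifs with h
    · subst h; simp [vertexAct, hx]
    · rfl
  rw [hR]
  by_cases hr : ∀ l' ∈ w.head?, ∀ k, ¬ G.Reducible sp (.real β k) l'
  · rw [← G.sum_ghostAct_real hs w (u := u)]
    refine Finset.sum_congr rfl fun k hk => ?_
    split_ifs with h
    · rw [G.realAct_of_not_reducible h hx (fun l' hl => hr l' hl k), ghostOp_single]
    · rw [G.realAct_of_le (not_lt.1 h), map_zero]
  push Not at hr
  obtain ⟨l', hl, k, hr⟩ := hr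
  rcases w with _ | ⟨⟨δ, j⟩ | ⟨δ, j⟩, w⟩
  · simp at hl
  · simp at hl; subst hl; exact hr.elim
  simp at hl; subst hl
  obtain ⟨rfl, hβ⟩ := hr
  have hN : G.weight β = G.maxWeight (G.src β) := by
    conv_lhs => rw [hβ]
    exact hsp.weight β
  have hmax : ∀ γ, G.src γ = G.src β → G.weight γ ≤ G.weight β := fun γ h => by
    rw [hN, ← h]; exact weight_le_maxWeight γ
  rw [max_eq_right (hmax α hs)]
  have key : ∀ k ∈ Finset.range (G.weight β),
      G.ghostOp R u α k (G.realAct R sp u β k (.ghost β j :: w)) =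
      (if k = j then G.ghostAct R u α k w else 0) - ∑ γ ∈ (G.out (G.src β)).erase β,
        if j < G.weight γ then (if k < G.weight γ then
          G.ghostAct R u α k (.real γ k :: .ghost γ j :: w) else 0) else 0 := by
    intro k hk
    rw [G.realAct_of_reducible j w (Finset.mem_range.1 hk) hβ, map_sub, map_sum]
    congr 1
    · split_ifs <;> simp
    · refine Finset.sum_congr rfl fun γ _ => ?_
      unfold realGhost
      by_cases h1 : j < G.weight γ <;> by_cases h2 : k < G.weight γ <;> simp [h1, h2]
  rw [Finset.sum_congr rfl key, Finset.sum_sub_distrib, Finset.sum_ite_eq',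
    if_pos (Finset.mem_range.2 hw.1), Finset.sum_comm]
  have key2 : ∀ γ ∈ (G.out (G.src β)).erase β, ∑ k ∈ Finset.range (G.weight β),
      (if j < G.weight γ then (if k < G.weight γ then
          G.ghostAct R u α k (.real γ k :: .ghost γ j :: w) else 0) else 0) =
      if α = γ then (if j < G.weight α then Finsupp.single (.ghost α j :: w) 1 else 0) else 0 := by
    intro γ hγ
    have hγ' := mem_out.1 (Finset.mem_erase.1 hγ).2
    by_cases hj : j < G.weight γ
    · simp only [hj, if_true]
      rw [G.sum_range_ghostAct_real (hs.trans hγ'.symm) _ (max_le (hmax _ hs) (hmax _ hγ'))]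
      by_cases h1 : α = γ
      · subst h1; simp [hj]
      · simp [h1]
    · simp only [hj, if_false, Finset.sum_const_zero]
      rw [eq_comm, ite_eq_right_iff]
      rintro rfl
      exact if_neg hj
  rw [Finset.sum_congr rfl key2, Finset.sum_ite_eq]
  have hA : G.ghostAct R u α j w =
      if j < G.weight α then Finsupp.single (.ghost α j :: w) 1 else 0 := by
    split_ifs with h
    · refine G.ghostAct_of_not_reducible (sp := sp) h (hs.trans hw.2.1) fun l' hl => ?_
      have := hw.2.2.1 l' hl
      rcases l' with _ | _ <;> exact this
    · exact G.ghostAct_of_le (not_lt.1 h)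
  rw [hA]
  by_cases h : α = β
  · subst h
    have : j < G.weight α := hw.1
    simp [this]
  · simp [h, mem_out, hs]

end Relations

/-! ### The representation on the span of the normal words -/

section Representation

variable (R : Type w) [Ring R] (sp : V → E) (u : V)

/-- The operator of a letter. -/
noncomputable def letterOp : G.Letter → Module.End R (List (Step E) →₀ R)
  | .vertex x => G.vertexOp R u x
  | .edge α i => G.realOp R sp u α i
  | .ghost α i => G.ghostOp R u α i

/-- The operator of a monomial, as an additive endomorphism. -/
noncomputable def wordOp :
    FreeSemigroup G.Letter →ₙ* AddMonoid.End (List (Step E) →₀ R) where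
  toFun w := (FreeSemigroup.lift (G.letterOp R sp u) w).toAddMonoidHom
  map_mul' a b := by rw [map_mul]; rfl

/-- The action of the free `R`-ring on the free module on words. -/
noncomputable def rep : G.FreeRing R →+ AddMonoid.End (List (Step E) →₀ R) :=
  MonoidAlgebra.liftNC (Module.toAddMonoidEnd R (List (Step E) →₀ R) : R →+ _) (G.wordOp R sp u)

variable {R}

theorem rep_single (w : FreeSemigroup G.Letter) (r : R) (m : List (Step E) →₀ R) :
    G.rep R sp u (MonoidAlgebra.single w r) m =
      r • FreeSemigroup.lift (G.letterOp R sp u) w m := by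
  unfold rep
  rw [MonoidAlgebra.liftNC_single]
  rfl

/-- Words act by left `R`-linear maps and hence commute with scalars. Scalars themselves act only
additively when `R` is not commutative, hence the target `AddMonoid.End`. -/
theorem rep_mul (a b : G.FreeRing R) :
    G.rep R sp u (a * b) = G.rep R sp u a * G.rep R sp u b := by
  refine MonoidAlgebra.liftNC_mul _ (G.wordOp R sp u) a b fun {x y} _ => ?_
  refine AddMonoidHom.ext fun m => ?_
  exact ((FreeSemigroup.lift (G.letterOp R sp u) y).map_smul _ m).symm

theorem rep_mul_apply (a b : G.FreeRing R) (m : List (Step E) →₀ R) :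
    G.rep R sp u (a * b) m = G.rep R sp u a (G.rep R sp u b m) := by
  rw [rep_mul]; rfl

theorem rep_add_apply (a b : G.FreeRing R) (m : List (Step E) →₀ R) :
    G.rep R sp u (a + b) m = G.rep R sp u a m + G.rep R sp u b m := by
  rw [map_add]; rfl

theorem rep_sum_apply {ι : Type*} (s : Finset ι) (f : ι → G.FreeRing R)
    (m : List (Step E) →₀ R) :
    G.rep R sp u (∑ i ∈ s, f i) m = ∑ i ∈ s, G.rep R sp u (f i) m := by
  classical
  induction s using Finset.induction_on with
  | empty => simp
  | insert i s hi ih => rw [Finset.sum_insert hi, Finset.sum_insert hi, rep_add_apply, ih]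

theorem rep_smul (r : R) (a : G.FreeRing R) (m : List (Step E) →₀ R) :
    G.rep R sp u (r • a) m = r • G.rep R sp u a m := by
  induction a using MonoidAlgebra.induction_linear with
  | zero => simp
  | add a b ha hb => rw [smul_add, rep_add_apply, rep_add_apply,
      ha, hb, smul_add]
  | single w s => rw [MonoidAlgebra.smul_single, rep_single, rep_single, smul_eq_mul, mul_smul]

/-- Needed because the ideal is also closed under right scalars, which act before the element does.
-/
theorem rep_op_smul (r : R) (a : G.FreeRing R) (m : List (Step E) →₀ R) :
    G.rep R sp u (MulOpposite.op r • a) m = G.rep R sp u a (r • m) := by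
  induction a using MonoidAlgebra.induction_linear with
  | zero => simp
  | add a b ha hb => rw [smul_add, rep_add_apply, rep_add_apply,
      ha, hb]
  | single w s => rw [MonoidAlgebra.smul_single, rep_single, rep_single, op_smul_eq_mul,
      mul_smul, map_smul]

theorem rep_gen (l : G.Letter) (m : List (Step E) →₀ R) :
    G.rep R sp u (G.gen R l) m = G.letterOp R sp u l m := by
  rw [gen, rep_single, one_smul, FreeSemigroup.lift_of]

theorem rep_vtx (x : V) (m : List (Step E) →₀ R) :
    G.rep R sp u (G.vtx R x) m = G.vertexOp R u x m :=
  G.rep_gen sp u _ m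

theorem rep_edg (α : E) (i : ℕ) (m : List (Step E) →₀ R) :
    G.rep R sp u (G.edg R α i) m = G.realOp R sp u α i m := by
  unfold edg
  split_ifs with h
  · exact G.rep_gen sp u _ m
  · have : G.realAct R sp u α i = 0 := funext fun w => G.realAct_of_le (not_lt.1 h)
    rw [realOp, this, map_zero]
    simp

theorem rep_gho (α : E) (i : ℕ) (m : List (Step E) →₀ R) :
    G.rep R sp u (G.gho R α i) m = G.ghostOp R u α i m := by
  unfold gho
  split_ifs with h
  · exact G.rep_gen sp u _ m
  · have : G.ghostAct R u α i = 0 := funext fun w => G.ghostAct_of_le (not_lt.1 h)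
    rw [ghostOp, this, map_zero]
    simp

variable {sp u}

theorem normalSpan_induction {p : (List (Step E) →₀ R) → Prop} (zero : p 0)
    (add : ∀ m n, p m → p n → p (m + n)) (smul : ∀ (r : R) m, p m → p (r • m))
    (single : ∀ w, G.IsNormal sp u w → p (Finsupp.single w 1))
    {m : List (Step E) →₀ R} (hm : m ∈ G.normalSpan R sp u) : p m := by
  rw [normalSpan, Finsupp.supported_eq_span_single] at hm
  induction hm using Submodule.span_induction with
  | mem x hx => obtain ⟨w, hw, rfl⟩ := hx; exact single w hw
  | zero => exact zero
  | add x y _ _ hx hy => exact add x y hx hy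
  | smul r x _ hx => exact smul r x hx

theorem letterOp_mem (l : G.Letter) {m : List (Step E) →₀ R} (hm : m ∈ G.normalSpan R sp u) :
    G.letterOp R sp u l m ∈ G.normalSpan R sp u := by
  refine G.normalSpan_induction (p := fun m => G.letterOp R sp u l m ∈ G.normalSpan R sp u)
    ?_ ?_ ?_ ?_ hm
  · simp
  · intro m n h1 h2; rw [map_add]; exact add_mem h1 h2
  · intro r m h; rw [map_smul]; exact Submodule.smul_mem _ r h
  · intro w hw
    rcases l with x | ⟨α, i⟩ | ⟨α, i⟩
    · simpa [letterOp] using G.vertexAct_mem hw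
    · simpa [letterOp] using G.realAct_mem hw
    · simpa [letterOp] using G.ghostAct_mem hw

theorem rep_mem (a : G.FreeRing R) {m : List (Step E) →₀ R} (hm : m ∈ G.normalSpan R sp u) :
    G.rep R sp u a m ∈ G.normalSpan R sp u := by
  induction a using MonoidAlgebra.induction_linear with
  | zero => simp
  | add a b ha hb => rw [rep_add_apply]; exact add_mem ha hb
  | single w r =>
    rw [rep_single]
    refine Submodule.smul_mem _ r ?_
    induction w using FreeSemigroup.recOnMul generalizing m with
    | ih1 l => rw [FreeSemigroup.lift_of]; exact G.letterOp_mem l hm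
    | ih2 l w _ hw =>
      rw [map_mul, FreeSemigroup.lift_of]
      exact G.letterOp_mem l (hw hm)

theorem eqOn_normalSpan {A B : Module.End R (List (Step E) →₀ R)}
    (h : ∀ w, G.IsNormal sp u w → A (Finsupp.single w 1) = B (Finsupp.single w 1))
    {m : List (Step E) →₀ R} (hm : m ∈ G.normalSpan R sp u) : A m = B m := by
  refine G.normalSpan_induction (p := fun m => A m = B m) ?_ ?_ ?_ h hm
  · rw [map_zero, map_zero]
  · intro m n h1 h2; rw [map_add, map_add, h1, h2]
  · intro r m h; rw [map_smul, map_smul, h]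

theorem rep_eq_of_leavittRel (hsp : G.IsSelector sp) {a b : G.FreeRing R}
    (h : G.LeavittRel R a b) {m : List (Step E) →₀ R} (hm : m ∈ G.normalSpan R sp u) :
    G.rep R sp u a m = G.rep R sp u b m := by
  classical
  have hz : G.rep R sp u 0 m = 0 := by rw [map_zero]; rfl
  induction h with
  | vertex_mul x y =>
    have := G.eqOn_normalSpan (A := G.vertexOp R u x * G.vertexOp R u y)
      (B := if x = y then G.vertexOp R u x else 0) (fun w _ => by
        rw [Module.End.mul_apply, vertexOp_single, vertexOp_vertexAct]
        split_ifs <;> simp) hm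
    rw [rep_mul_apply, rep_vtx, rep_vtx]
    refine this.trans ?_
    split_ifs
    · rw [rep_vtx]
    · rw [hz]; rfl
  | src_edge α i hi =>
    rw [rep_mul_apply, rep_vtx, rep_edg]
    exact G.eqOn_normalSpan (A := G.vertexOp R u (G.src α) * G.realOp R sp u α i)
      (B := G.realOp R sp u α i) (fun w hw => by
        rw [Module.End.mul_apply, realOp_single,
          G.vertexOp_of_supported (G.realAct_mem_supported hw)]) hm
  | edge_rng α i hi =>
    rw [rep_mul_apply, rep_vtx, rep_edg, rep_edg]
    exact G.eqOn_normalSpan (A := G.realOp R sp u α i * G.vertexOp R u (G.rng α))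
      (B := G.realOp R sp u α i) (fun w hw => by
        rw [Module.End.mul_apply, realOp_single, vertexOp_single, realOp_vertexAct]) hm
  | rng_ghost α i hi =>
    rw [rep_mul_apply, rep_vtx, rep_gho]
    exact G.eqOn_normalSpan (A := G.vertexOp R u (G.rng α) * G.ghostOp R u α i)
      (B := G.ghostOp R u α i) (fun w hw => by
        rw [Module.End.mul_apply, ghostOp_single,
          G.vertexOp_of_supported (G.ghostAct_mem_supported hw)]) hm
  | ghost_src α i hi =>
    rw [rep_mul_apply, rep_vtx, rep_gho, rep_gho]
    exact G.eqOn_normalSpan (A := G.ghostOp R u α i * G.vertexOp R u (G.src α))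
      (B := G.ghostOp R u α i) (fun w hw => by
        rw [Module.End.mul_apply, ghostOp_single, vertexOp_single, ghostOp_vertexAct]) hm
  | sum_edge_ghost x i j hi hj =>
    have := G.eqOn_normalSpan (A := ∑ α ∈ G.out x, G.realOp R sp u α i * G.ghostOp R u α j)
      (B := if i = j then G.vertexOp R u x else 0) (fun w hw => by
        rw [LinearMap.sum_apply]
        simp only [Module.End.mul_apply, ghostOp_single]
        rw [G.sum_realOp_ghostAct hsp hi hj hw]
        split_ifs <;> simp) hm
    rw [rep_sum_apply]
    simp only [rep_mul_apply, rep_edg, rep_gho]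
    rw [LinearMap.sum_apply] at this
    refine Eq.trans this ?_
    split_ifs
    · rw [rep_vtx]
    · rw [hz]; rfl
  | sum_ghost_edge α β =>
    have := G.eqOn_normalSpan (A := ∑ k ∈ Finset.range (max (G.weight α) (G.weight β)),
        G.ghostOp R u α k * G.realOp R sp u β k)
      (B := if α = β then G.vertexOp R u (G.rng α) else 0) (fun w hw => by
        rw [LinearMap.sum_apply]
        simp only [Module.End.mul_apply, realOp_single]
        rw [G.sum_ghostOp_realAct hsp α β hw]
        split_ifs <;> simp) hm
    rw [rep_sum_apply]
    simp only [rep_mul_apply, rep_edg, rep_gho]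
    rw [LinearMap.sum_apply] at this
    refine Eq.trans this ?_
    split_ifs
    · rw [rep_vtx]
    · rw [hz]; rfl

theorem rep_eq_zero_of_mem (hsp : G.IsSelector sp) {a : G.FreeRing R}
    (ha : a ∈ G.leavittIdeal R) {m : List (Step E) →₀ R} (hm : m ∈ G.normalSpan R sp u) :
    G.rep R sp u a m = 0 := by
  -- The annihilator of the normal span competes in the infimum defining the ideal; closure under
  -- right multiplication uses that the span is invariant.
  let J : TwoSidedIdeal (G.FreeRing R) := .mk'
    {a | ∀ m ∈ G.normalSpan R sp u, G.rep R sp u a m = 0}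
    (fun m _ => by rw [map_zero]; rfl)
    (fun ha hb m hm => by rw [rep_add_apply, ha m hm, hb m hm, add_zero])
    (fun {a} ha m hm => by rw [map_neg]; exact neg_eq_zero.2 (ha m hm))
    (fun hb m hm => by rw [rep_mul_apply, hb m hm, map_zero])
    (fun ha m hm => by rw [rep_mul_apply, ha _ (G.rep_mem _ hm)])
  have hJ : ∀ a, a ∈ J ↔ ∀ m ∈ G.normalSpan R sp u, G.rep R sp u a m = 0 := fun a =>
    TwoSidedIdeal.mem_mk' ..
  have hle : G.leavittIdeal R ≤ J := by
    refine sInf_le ⟨fun r a ha => ?_, fun r a ha => ?_, fun a b h => ?_⟩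
    · rw [hJ] at ha ⊢
      intro m hm
      rw [rep_smul, ha m hm, smul_zero]
    · rw [hJ] at ha ⊢
      intro m hm
      rw [rep_op_smul, ha _ (Submodule.smul_mem _ r hm)]
    · rw [hJ]
      intro m hm
      rw [map_sub]
      exact sub_eq_zero.2 (G.rep_eq_of_leavittRel hsp h hm)
  exact (hJ a).1 (TwoSidedIdeal.le_iff.1 hle ha) m hm

end Representation

/-! ### Expansion in normal words inside the algebra -/

section Quotient

variable (R : Type w) [Ring R]

/-- The quotient map onto the weighted Leavitt path algebra. -/
noncomputable def toLeavitt : G.FreeRing R →ₙ+* G.LeavittPathAlgebra R where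
  toFun a := (a : (G.leavittIdeal R).ringCon.Quotient)
  map_mul' _ _ := rfl
  map_zero' := rfl
  map_add' _ _ := rfl

variable {R}

theorem toLeavitt_surjective : Function.Surjective (G.toLeavitt R) := fun x =>
  Quotient.inductionOn' x fun a => ⟨a, rfl⟩

theorem toLeavitt_eq_iff {a b : G.FreeRing R} :
    G.toLeavitt R a = G.toLeavitt R b ↔ a - b ∈ G.leavittIdeal R :=
  (RingCon.eq _).trans (TwoSidedIdeal.rel_iff _ _ _)

theorem toLeavitt_eq_of_rel {a b : G.FreeRing R} (h : G.LeavittRel R a b) :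
    G.toLeavitt R a = G.toLeavitt R b := by
  rw [toLeavitt_eq_iff, leavittIdeal, TwoSidedIdeal.mem_sInf]
  exact fun J hJ => hJ.2.2 a b h

/-- The quotient is used as a ring only; this compatibility replaces a module structure on it. -/
theorem toLeavitt_smul {a b : G.FreeRing R} (r : R) (h : G.toLeavitt R a = G.toLeavitt R b) :
    G.toLeavitt R (r • a) = G.toLeavitt R (r • b) := by
  rw [toLeavitt_eq_iff] at h ⊢
  rw [← smul_sub]
  rw [leavittIdeal, TwoSidedIdeal.mem_sInf] at h ⊢
  exact fun J hJ => hJ.1 r _ (h J hJ)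

theorem toLeavitt_vtx_mul_vtx [DecidableEq V] (x y : V) :
    G.toLeavitt R (G.vtx R x) * G.toLeavitt R (G.vtx R y) =
      if x = y then G.toLeavitt R (G.vtx R x) else 0 := by
  rw [← map_mul, G.toLeavitt_eq_of_rel (.vertex_mul x y)]
  split_ifs <;> simp

variable (R)

/-- The element of the free `R`-ring given by a step. -/
noncomputable def stepElt : Step E → G.FreeRing R
  | .real α i => G.edg R α i
  | .ghost α i => G.gho R α i

/-- The element of the free `R`-ring given by a word ending in `u`. -/
noncomputable def wordElt (u : V) : List (Step E) → G.FreeRing R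
  | [] => G.vtx R u
  | l :: w => G.stepElt R l * wordElt u w

/-- The linear extension of `wordElt`. -/
noncomputable def wordSum (u : V) : (List (Step E) →₀ R) →ₗ[R] G.FreeRing R :=
  Finsupp.linearCombination R (G.wordElt R u)

variable {R}

@[simp] theorem wordSum_single (u : V) (w : List (Step E)) (r : R) :
    G.wordSum R u (Finsupp.single w r) = r • G.wordElt R u w := by
  simp [wordSum]

theorem edg_of_le {α : E} {i : ℕ} (h : G.weight α ≤ i) : G.edg R α i = 0 := by
  simp [edg, h]

theorem gho_of_le {α : E} {i : ℕ} (h : G.weight α ≤ i) : G.gho R α i = 0 := by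
  simp [gho, h]

theorem toLeavitt_src_mul_edg (α : E) (i : ℕ) :
    G.toLeavitt R (G.vtx R (G.src α)) * G.toLeavitt R (G.edg R α i) =
      G.toLeavitt R (G.edg R α i) := by
  by_cases h : i < G.weight α
  · rw [← map_mul, G.toLeavitt_eq_of_rel (.src_edge α i h)]
  · simp [G.edg_of_le (not_lt.1 h)]

theorem toLeavitt_edg_mul_rng (α : E) (i : ℕ) :
    G.toLeavitt R (G.edg R α i) * G.toLeavitt R (G.vtx R (G.rng α)) =
      G.toLeavitt R (G.edg R α i) := by
  by_cases h : i < G.weight α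
  · rw [← map_mul, G.toLeavitt_eq_of_rel (.edge_rng α i h)]
  · simp [G.edg_of_le (not_lt.1 h)]

theorem toLeavitt_rng_mul_gho (α : E) (i : ℕ) :
    G.toLeavitt R (G.vtx R (G.rng α)) * G.toLeavitt R (G.gho R α i) =
      G.toLeavitt R (G.gho R α i) := by
  by_cases h : i < G.weight α
  · rw [← map_mul, G.toLeavitt_eq_of_rel (.rng_ghost α i h)]
  · simp [G.gho_of_le (not_lt.1 h)]

theorem toLeavitt_gho_mul_src (α : E) (i : ℕ) :
    G.toLeavitt R (G.gho R α i) * G.toLeavitt R (G.vtx R (G.src α)) =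
      G.toLeavitt R (G.gho R α i) := by
  by_cases h : i < G.weight α
  · rw [← map_mul, G.toLeavitt_eq_of_rel (.ghost_src α i h)]
  · simp [G.gho_of_le (not_lt.1 h)]

theorem toLeavitt_stepSrc_mul (l : Step E) :
    G.toLeavitt R (G.vtx R (G.stepSrc l)) * G.toLeavitt R (G.stepElt R l) =
      G.toLeavitt R (G.stepElt R l) := by
  cases l
  · exact G.toLeavitt_src_mul_edg _ _
  · exact G.toLeavitt_rng_mul_gho _ _

theorem toLeavitt_wordSrc_mul (u : V) (w : List (Step E)) :
    G.toLeavitt R (G.vtx R (G.wordSrc u w)) * G.toLeavitt R (G.wordElt R u w) =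
      G.toLeavitt R (G.wordElt R u w) := by
  classical
  cases w with
  | nil => simp [wordElt, wordSrc, toLeavitt_vtx_mul_vtx]
  | cons l w => rw [wordElt, wordSrc, map_mul, ← mul_assoc, toLeavitt_stepSrc_mul]

theorem toLeavitt_vtx_mul_wordElt [DecidableEq V] (x u : V) (w : List (Step E)) :
    G.toLeavitt R (G.vtx R x) * G.toLeavitt R (G.wordElt R u w) =
      if G.wordSrc u w = x then G.toLeavitt R (G.wordElt R u w) else 0 := by
  rw [← toLeavitt_wordSrc_mul, ← mul_assoc, toLeavitt_vtx_mul_vtx]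
  by_cases h : x = G.wordSrc u w
  · simp [h]
  · simp [h, Ne.symm h]

variable {sp : V → E} {u : V}

theorem toLeavitt_wordSum_realGhost (γ : E) (i j : ℕ) (w : List (Step E)) :
    G.toLeavitt R (G.wordSum R u (G.realGhost R γ i j w)) =
      G.toLeavitt R (G.edg R γ i) * G.toLeavitt R (G.gho R γ j) *
        G.toLeavitt R (G.wordElt R u w) := by
  unfold realGhost
  split_ifs with h
  · simp [wordElt, stepElt, mul_assoc]
  · rw [not_and_or, not_lt, not_lt] at h
    rcases h with h | h
    · simp [G.edg_of_le h]
    · simp [G.gho_of_le h]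

theorem toLeavitt_wordSum_ghostReal (α β : E) (k : ℕ) (w : List (Step E)) :
    G.toLeavitt R (G.wordSum R u (G.ghostReal R α β k w)) =
      G.toLeavitt R (G.gho R α k) * G.toLeavitt R (G.edg R β k) *
        G.toLeavitt R (G.wordElt R u w) := by
  unfold ghostReal
  split_ifs with h
  · simp [wordElt, stepElt, mul_assoc]
  · rw [not_and_or, not_lt, not_lt] at h
    rcases h with h | h
    · simp [G.gho_of_le h]
    · simp [G.edg_of_le h]

theorem toLeavitt_edg_mul_wordElt {α : E} {i : ℕ} {w : List (Step E)}
    (hsp : G.IsSelector sp) (hw : G.IsNormal sp u w) :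
    G.toLeavitt R (G.edg R α i) * G.toLeavitt R (G.wordElt R u w) =
      G.toLeavitt R (G.wordSum R u (G.realAct R sp u α i w)) := by
  classical
  by_cases hi : i < G.weight α
  swap
  · rw [G.realAct_of_le (not_lt.1 hi), G.edg_of_le (not_lt.1 hi)]; simp
  by_cases hs : G.rng α = G.wordSrc u w
  swap
  · rw [G.realAct_of_ne hs, ← toLeavitt_edg_mul_rng, mul_assoc, toLeavitt_vtx_mul_wordElt,
      if_neg (Ne.symm hs)]
    simp
  by_cases hr : ∀ l' ∈ w.head?, ¬ G.Reducible sp (.real α i) l'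
  · rw [G.realAct_of_not_reducible hi hs hr, wordSum_single, one_smul, wordElt, map_mul, stepElt]
  push Not at hr
  obtain ⟨l', hl, hr⟩ := hr
  rcases w with _ | ⟨⟨β, j⟩ | ⟨β, j⟩, w⟩
  · simp at hl
  · simp at hl; subst hl; exact hr.elim
  simp at hl; subst hl
  obtain ⟨rfl, hα⟩ := hr
  -- Relation (3) is available only for indices below `ω(v)`; the selected edge has this weight, so
  -- both indices qualify.
  have hN : G.weight α = G.maxWeight (G.src α) := by
    conv_lhs => rw [hα]
    exact hsp.weight α
  have hj : j < G.weight α := hw.1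
  rw [G.realAct_of_reducible j w hi hα, map_sub, map_sub, map_sum, map_sum, wordElt, map_mul,
    ← mul_assoc, stepElt]
  simp only [toLeavitt_wordSum_realGhost]
  rw [← Finset.sum_mul, eq_sub_iff_add_eq, ← add_mul,
    Finset.add_sum_erase _ (fun γ => G.toLeavitt R (G.edg R γ i) * G.toLeavitt R (G.gho R γ j))
      (mem_out.2 rfl)]
  have := G.toLeavitt_eq_of_rel (R := R) (.sum_edge_ghost (G.src α) i j (hN ▸ hi) (hN ▸ hj))
  rw [map_sum] at this
  simp only [map_mul] at this
  rw [this]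
  split_ifs
  · have h0 := hw.2.1.symm
    simp only [stepRng] at h0
    rw [toLeavitt_vtx_mul_wordElt, if_pos h0, wordSum_single, one_smul]
  · simp

theorem toLeavitt_gho_mul_wordElt {α : E} {i : ℕ} {w : List (Step E)}
    (hw : G.IsNormal sp u w) :
    G.toLeavitt R (G.gho R α i) * G.toLeavitt R (G.wordElt R u w) =
      G.toLeavitt R (G.wordSum R u (G.ghostAct R u α i w)) := by
  classical
  by_cases hi : i < G.weight α
  swap
  · rw [G.ghostAct_of_le (not_lt.1 hi), G.gho_of_le (not_lt.1 hi)]; simp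
  by_cases hs : G.src α = G.wordSrc u w
  swap
  · rw [G.ghostAct_of_ne hs, ← toLeavitt_gho_mul_src, mul_assoc, toLeavitt_vtx_mul_wordElt,
      if_neg (Ne.symm hs)]
    simp
  by_cases hr : ∀ l' ∈ w.head?, ¬ G.Reducible sp (.ghost α i) l'
  · rw [G.ghostAct_of_not_reducible hi hs hr, wordSum_single, one_smul, wordElt, map_mul, stepElt]
  push Not at hr
  obtain ⟨l', hl, hr⟩ := hr
  rcases w with _ | ⟨⟨β, j⟩ | ⟨β, j⟩, w⟩
  · simp at hl
  swap
  · simp at hl; subst hl; exact hr.elim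
  simp at hl; subst hl
  obtain ⟨rfl, rfl⟩ := hr
  rw [G.ghostAct_of_reducible w hs, map_sub, map_sub, map_sum, map_sum, wordElt, map_mul,
    ← mul_assoc, stepElt]
  simp only [toLeavitt_wordSum_ghostReal]
  have hpos : 0 < max (G.weight α) (G.weight β) := lt_max_of_lt_left (G.weight_pos α)
  rw [← Finset.sum_mul, eq_sub_iff_add_eq, ← add_mul]
  have := G.toLeavitt_eq_of_rel (R := R) (.sum_ghost_edge α β)
  rw [map_sum] at this
  simp only [map_mul] at this
  rw [Finset.range_eq_Ico, Finset.sum_eq_sum_Ico_succ_bot hpos] at this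
  rw [this]
  split_ifs with h
  · subst h
    have h0 := hw.2.1.symm
    simp only [stepRng] at h0
    rw [toLeavitt_vtx_mul_wordElt, if_pos h0, wordSum_single, one_smul]
  · simp

theorem toLeavitt_vtx_mul_wordSum (x : V) (w : List (Step E)) :
    G.toLeavitt R (G.vtx R x) * G.toLeavitt R (G.wordElt R u w) =
      G.toLeavitt R (G.wordSum R u (G.vertexAct R u x w)) := by
  classical
  rw [toLeavitt_vtx_mul_wordElt, vertexAct]
  split_ifs <;> simp

theorem edg_fin (α : E) (i : Fin (G.weight α)) : G.edg R α i = G.gen R (.edge α i) := by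
  simp [edg]

theorem gho_fin (α : E) (i : Fin (G.weight α)) : G.gho R α i = G.gen R (.ghost α i) := by
  simp [gho]

theorem gen_mul_smul (l : G.Letter) (r : R) (a : G.FreeRing R) :
    G.gen R l * (r • a) = r • (G.gen R l * a) := by
  induction a using MonoidAlgebra.induction_linear with
  | zero => simp
  | add a b ha hb => rw [smul_add, mul_add, mul_add, smul_add, ha, hb]
  | single w s => simp [gen, MonoidAlgebra.single_mul_single]

theorem toLeavitt_gen_mul_wordSum (hsp : G.IsSelector sp) (l : G.Letter)
    {m : List (Step E) →₀ R} (hm : m ∈ G.normalSpan R sp u) :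
    G.toLeavitt R (G.gen R l * G.wordSum R u m) =
      G.toLeavitt R (G.wordSum R u (G.letterOp R sp u l m)) := by
  refine G.normalSpan_induction (p := fun m => G.toLeavitt R (G.gen R l * G.wordSum R u m) =
      G.toLeavitt R (G.wordSum R u (G.letterOp R sp u l m))) ?_ ?_ ?_ ?_ hm
  · simp
  · intro m n h1 h2
    rw [map_add, mul_add, map_add, map_add, map_add, map_add, h1, h2]
  · intro r m h
    rw [map_smul, map_smul, map_smul, gen_mul_smul]
    exact G.toLeavitt_smul r h
  · intro w hw
    rw [wordSum_single, one_smul, map_mul]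
    rcases l with x | ⟨α, i⟩ | ⟨α, i⟩
    · rw [letterOp, vertexOp_single]; exact G.toLeavitt_vtx_mul_wordSum x w
    · rw [letterOp, realOp_single, ← edg_fin]; exact G.toLeavitt_edg_mul_wordElt hsp hw
    · rw [letterOp, ghostOp_single, ← gho_fin]; exact G.toLeavitt_gho_mul_wordElt hw

/-- Evaluation of words intertwines the representation with left multiplication. At the empty word,
which evaluates to `u`, this expands every `au` in normal words. -/
theorem toLeavitt_mul_wordSum (hsp : G.IsSelector sp) (a : G.FreeRing R)
    {m : List (Step E) →₀ R} (hm : m ∈ G.normalSpan R sp u) :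
    G.toLeavitt R (a * G.wordSum R u m) =
      G.toLeavitt R (G.wordSum R u (G.rep R sp u a m)) := by
  induction a using MonoidAlgebra.induction_linear with
  | zero =>
    rw [zero_mul, map_zero]
    have : G.rep R sp u 0 m = 0 := by rw [map_zero]; rfl
    rw [this, map_zero, map_zero]
  | add a b ha hb => rw [rep_add_apply, add_mul, map_add, map_add, map_add, ha, hb]
  | single w r =>
    rw [rep_single, map_smul]
    have hrw : (MonoidAlgebra.single w r : G.FreeRing R) * G.wordSum R u m =
        r • ((MonoidAlgebra.single w 1 : G.FreeRing R) * G.wordSum R u m) := by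
      rw [← smul_mul_assoc, MonoidAlgebra.smul_single, smul_eq_mul, mul_one]
    rw [hrw]
    refine G.toLeavitt_smul r ?_
    clear hrw
    induction w using FreeSemigroup.recOnMul generalizing m with
    | ih1 l => rw [FreeSemigroup.lift_of]; exact G.toLeavitt_gen_mul_wordSum hsp l hm
    | ih2 l w _ hw =>
      have hm' : FreeSemigroup.lift (G.letterOp R sp u) w m ∈ G.normalSpan R sp u := by
        have := G.rep_mem (MonoidAlgebra.single w 1) hm
        rwa [rep_single, one_smul] at this
      have h1 : (MonoidAlgebra.single (FreeSemigroup.of l * w) 1 : G.FreeRing R) =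
          G.gen R l * MonoidAlgebra.single w 1 := by
        simp [gen, MonoidAlgebra.single_mul_single]
      have h2 : FreeSemigroup.lift (G.letterOp R sp u) (FreeSemigroup.of l * w) m =
          G.letterOp R sp u l (FreeSemigroup.lift (G.letterOp R sp u) w m) := by
        rw [map_mul, FreeSemigroup.lift_of]; rfl
      rw [h1, h2, mul_assoc, map_mul, hw hm, ← map_mul]
      exact G.toLeavitt_gen_mul_wordSum hsp l hm'

/-! ### Vertices as local units -/

/-- Every monomial has a range. -/
theorem exists_single_mul_vtx [DecidableEq V] (w : FreeSemigroup G.Letter) :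
    ∃ z, ∀ (r : R) (x : V), G.toLeavitt R (MonoidAlgebra.single w r) * G.toLeavitt R (G.vtx R x) =
      if z = x then G.toLeavitt R (MonoidAlgebra.single w r) else 0 := by
  induction w using FreeSemigroup.recOnMul with
  | ih1 l =>
    have h1 : G.toLeavitt R (G.gen R l) * G.toLeavitt R (G.vtx R l.range) =
        G.toLeavitt R (G.gen R l) := by
      rcases l with x | ⟨α, i⟩ | ⟨α, i⟩
      · exact (G.toLeavitt_vtx_mul_vtx x x).trans (if_pos rfl)
      · rw [← edg_fin]; exact G.toLeavitt_edg_mul_rng α i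
      · rw [← gho_fin]; exact G.toLeavitt_gho_mul_src α i
    refine ⟨l.range, fun r x => ?_⟩
    have h2 : G.toLeavitt R (G.gen R l * G.vtx R x) =
        G.toLeavitt R (if l.range = x then G.gen R l else 0) := by
      rw [map_mul, ← h1, mul_assoc, toLeavitt_vtx_mul_vtx]
      split_ifs with h
      · exact h1
      · simp
    have h3 := G.toLeavitt_smul r h2
    rw [← smul_mul_assoc, smul_ite, smul_zero, gen, MonoidAlgebra.smul_single, smul_eq_mul,
      mul_one, map_mul] at h3
    rw [h3]
    split_ifs <;> simp
  | ih2 l w _ hw =>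
    obtain ⟨z, hz⟩ := hw
    refine ⟨z, fun r x => ?_⟩
    have h1 : (MonoidAlgebra.single (FreeSemigroup.of l * w) r : G.FreeRing R) =
        G.gen R l * MonoidAlgebra.single w r := by
      simp [gen, MonoidAlgebra.single_mul_single]
    rw [h1, map_mul, mul_assoc, hz]
    split_ifs <;> simp

/-- Every monomial has a source. -/
theorem exists_vtx_mul_single [DecidableEq V] (w : FreeSemigroup G.Letter) :
    ∃ z, ∀ (r : R) (x : V), G.toLeavitt R (G.vtx R x) * G.toLeavitt R (MonoidAlgebra.single w r) =
      if x = z then G.toLeavitt R (MonoidAlgebra.single w r) else 0 := by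
  have hl : ∀ l : G.Letter, G.toLeavitt R (G.vtx R l.source) * G.toLeavitt R (G.gen R l) =
      G.toLeavitt R (G.gen R l) := by
    rintro (x | ⟨α, i⟩ | ⟨α, i⟩)
    · exact (G.toLeavitt_vtx_mul_vtx x x).trans (if_pos rfl)
    · rw [← edg_fin]; exact G.toLeavitt_src_mul_edg α i
    · rw [← gho_fin]; exact G.toLeavitt_rng_mul_gho α i
  have hl' : ∀ (l : G.Letter) (x : V), G.toLeavitt R (G.vtx R x * G.gen R l) =
      G.toLeavitt R (if x = l.source then G.gen R l else 0) := by
    intro l x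
    rw [map_mul, ← hl, ← mul_assoc, toLeavitt_vtx_mul_vtx]
    split_ifs with h
    · rw [h, hl]
    · simp
  induction w using FreeSemigroup.recOnMul with
  | ih1 l =>
    refine ⟨l.source, fun r x => ?_⟩
    have h3 := G.toLeavitt_smul r (hl' l x)
    rw [vtx, ← gen_mul_smul, smul_ite, smul_zero, gen, gen, MonoidAlgebra.smul_single, smul_eq_mul,
      mul_one, map_mul] at h3
    rw [vtx, gen, h3]
    split_ifs <;> simp
  | ih2 l w _ _ =>
    refine ⟨l.source, fun r x => ?_⟩
    have h1 : (MonoidAlgebra.single (FreeSemigroup.of l * w) r : G.FreeRing R) =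
        G.gen R l * MonoidAlgebra.single w r := by
      simp [gen, MonoidAlgebra.single_mul_single]
    rw [h1, map_mul, ← mul_assoc, ← map_mul, hl']
    split_ifs <;> simp

/-- Allowing every larger finite set lets the sets for two summands be merged in the induction. -/
theorem exists_finset_mul_vtx (y : G.LeavittPathAlgebra R) :
    ∃ F : Finset V, ∀ F', F ⊆ F' → y = ∑ x ∈ F', y * G.toLeavitt R (G.vtx R x) := by
  classical
  obtain ⟨a, rfl⟩ := G.toLeavitt_surjective y
  induction a using MonoidAlgebra.induction_linear with
  | zero => exact ⟨∅, fun F' _ => by simp⟩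
  | add a b ha hb =>
    obtain ⟨F₁, h₁⟩ := ha
    obtain ⟨F₂, h₂⟩ := hb
    refine ⟨F₁ ∪ F₂, fun F' h => ?_⟩
    rw [map_add]
    simp only [add_mul]
    rw [Finset.sum_add_distrib, ← h₁ F' (Finset.union_subset_left h),
      ← h₂ F' (Finset.union_subset_right h)]
  | single w r =>
    obtain ⟨z, hz⟩ := G.exists_single_mul_vtx (R := R) w
    refine ⟨{z}, fun F' h => ?_⟩
    simp only [hz]
    rw [Finset.sum_ite_eq, if_pos (h (Finset.mem_singleton_self z))]

theorem exists_finset_vtx_mul (y : G.LeavittPathAlgebra R) :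
    ∃ F : Finset V, ∀ F', F ⊆ F' → y = ∑ x ∈ F', G.toLeavitt R (G.vtx R x) * y := by
  classical
  obtain ⟨a, rfl⟩ := G.toLeavitt_surjective y
  induction a using MonoidAlgebra.induction_linear with
  | zero => exact ⟨∅, fun F' _ => by simp⟩
  | add a b ha hb =>
    obtain ⟨F₁, h₁⟩ := ha
    obtain ⟨F₂, h₂⟩ := hb
    refine ⟨F₁ ∪ F₂, fun F' h => ?_⟩
    rw [map_add]
    simp only [mul_add]
    rw [Finset.sum_add_distrib, ← h₁ F' (Finset.union_subset_left h),
      ← h₂ F' (Finset.union_subset_right h)]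
  | single w r =>
    obtain ⟨z, hz⟩ := G.exists_vtx_mul_single (R := R) w
    refine ⟨{z}, fun F' h => ?_⟩
    simp only [hz]
    rw [Finset.sum_ite_eq', if_pos (h (Finset.mem_singleton_self z))]

theorem exists_mul_vtx_ne_zero {y : G.LeavittPathAlgebra R} (hy : y ≠ 0) :
    ∃ x, y * G.toLeavitt R (G.vtx R x) ≠ 0 := by
  by_contra! h
  obtain ⟨F, hF⟩ := G.exists_finset_mul_vtx y
  exact hy ((hF F subset_rfl).trans (Finset.sum_eq_zero fun x _ => h x))

theorem exists_vtx_mul_ne_zero {y : G.LeavittPathAlgebra R} (hy : y ≠ 0) :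
    ∃ x, G.toLeavitt R (G.vtx R x) * y ≠ 0 := by
  by_contra! h
  obtain ⟨F, hF⟩ := G.exists_finset_vtx_mul y
  exact hy ((hF F subset_rfl).trans (Finset.sum_eq_zero fun x _ => h x))

end Quotient

/-! ### Leading parts of the rewriting rules -/

section LeadingTerms

/-- `(a, b)` occurs in the leading part of the normal form of the reducible word `(l, l')`. -/
inductive Swap (sp : V → E) : Step E → Step E → Step E → Step E → Prop
  | real_ghost (c γ : E) (i j : ℕ) (hc : c = sp (G.src c)) (hs : G.src γ = G.src c) (hne : γ ≠ c)
      (hi : i < G.weight γ) (hj : j < G.weight γ) :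
      Swap sp (.real c i) (.ghost c j) (.real γ i) (.ghost γ j)
  | ghost_real (α β : E) (k : ℕ) (hk : 1 ≤ k) (hα : k < G.weight α) (hβ : k < G.weight β) :
      Swap sp (.ghost α 0) (.real β 0) (.ghost α k) (.real β k)

variable {G} {sp : V → E} {l l' m m' a b : Step E}

theorem Swap.reducible (h : G.Swap sp l l' a b) : G.Reducible sp l l' := by
  cases h with
  | real_ghost c γ i j hc => exact ⟨rfl, hc⟩
  | ghost_real => exact ⟨rfl, rfl⟩

theorem Swap.not_reducible (h : G.Swap sp l l' a b) : ¬ G.Reducible sp a b := by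
  cases h with
  | real_ghost c γ i j hc hs hne => exact fun h => hne (by rw [h.2, hs, ← hc])
  | ghost_real α β k hk => exact fun h => by have := h.1; omega

/-- In the first kind the reducible pair is recovered from the selected edge at the common source
and the retained indices; in the second kind from the retained edges and the index `0`. -/
theorem Swap.unique (h : G.Swap sp l l' a b) (h' : G.Swap sp m m' a b) : m = l ∧ m' = l' := by
  cases h with
  | real_ghost c γ i j hc hs hne =>
    cases h' with
    | real_ghost c' _ _ _ hc' hs' =>
      have : c' = c := by rw [hc, hc', ← hs, ← hs']
      subst this; exact ⟨rfl, rfl⟩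
  | ghost_real α β k hk =>
    cases h' with
    | ghost_real => exact ⟨rfl, rfl⟩

/-- Reducible pairs and members of leading parts have two equal edges (real–ghost) or two equal
indices (ghost–real). A mixed pair has neither coincidence, as the two pairs differ in precisely
that datum. The next three lemmas hold for the same reason. -/
theorem Swap.not_reducible_left (h : G.Swap sp l l' a b) : ¬ G.Reducible sp l b := by
  cases h with
  | real_ghost c γ i j hc hs hne => exact fun h => hne h.1.symm
  | ghost_real α β k hk => exact fun h => by have := h.2; omega

theorem Swap.not_swap_left (h : G.Swap sp l l' a b) : ¬ G.Swap sp m m' l b := by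
  intro h'
  cases h with
  | real_ghost c γ i j hc hs hne =>
    cases h'
    exact hne rfl
  | ghost_real α β k hk =>
    cases h'
    omega

theorem Swap.not_reducible_right (h : G.Swap sp l l' a b) : ¬ G.Reducible sp a l' := by
  cases h with
  | real_ghost c γ i j hc hs hne => exact fun h => hne h.1
  | ghost_real α β k hk => exact fun h => by have := h.1; omega

theorem Swap.not_swap_right (h : G.Swap sp l l' a b) : ¬ G.Swap sp m m' a l' := by
  intro h'
  cases h with
  | real_ghost c γ i j hc hs hne =>
    cases h'
    exact hne rfl
  | ghost_real α β k hk =>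
    cases h'
    omega

/-- In an LV-graph each reducible word of length two has a nonzero leading part. -/
theorem IsLV.exists_swap (hG : G.IsLV) (hsp : G.IsSelector sp) (h : G.Reducible sp l l')
    (hl : G.StepValid l) (hl' : G.StepValid l') : ∃ a b, G.Swap sp l l' a b := by
  classical
  rcases l with ⟨α, i⟩ | ⟨α, i⟩ <;> rcases l' with ⟨β, j⟩ | ⟨β, j⟩
  · exact h.elim
  · obtain ⟨rfl, hα⟩ := h
    -- A second edge of maximal weight admits the same indices `i` and `j` as the selected one.
    have h2 := hG.two_le_card (G.src α) ⟨α, mem_out.2 rfl⟩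
    obtain ⟨γ, hγ, hne⟩ := Finset.exists_mem_ne h2 α
    obtain ⟨h3, h4⟩ := Finset.mem_filter.1 hγ
    have hw := hsp.weight α
    rw [← hα, ← h4] at hw
    exact ⟨_, _, .real_ghost α γ i j hα (mem_out.1 h3) hne (hw ▸ hl) (hw ▸ hl')⟩
  · obtain ⟨rfl, rfl⟩ := h
    -- Index `1`, the second copy of each edge, exists since all weights are at least `2`.
    exact ⟨_, _, .ghost_real α β 1 le_rfl (hG.two_le_weight α) (hG.two_le_weight β)⟩
  · exact h.elim

variable (G) in
/-- Steps that admit the same predecessors in normal words. -/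
def Similar : Step E → Step E → Prop
  | .real α i, .real β j => G.src α = G.src β ∧ i = j
  | .ghost α _, .ghost β _ => α = β
  | _, _ => False

theorem Similar.refl (l : Step E) : G.Similar l l := by
  cases l
  · exact ⟨rfl, rfl⟩
  · exact Eq.refl _

theorem Similar.stepSrc_eq (h : G.Similar l m) : G.stepSrc l = G.stepSrc m := by
  rcases l with ⟨α, i⟩ | ⟨α, i⟩ <;> rcases m with ⟨β, j⟩ | ⟨β, j⟩
  · exact h.1
  · exact h.elim
  · exact h.elim
  · exact congrArg G.rng h

theorem Similar.reducible (h : G.Similar l m) (hr : G.Reducible sp a m) : G.Reducible sp a l := by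
  rcases a with ⟨γ, k⟩ | ⟨γ, k⟩ <;> rcases l with ⟨α, i⟩ | ⟨α, i⟩ <;>
    rcases m with ⟨β, j⟩ | ⟨β, j⟩ <;> simp_all [Similar, Reducible]
  exact hr.1 ▸ hr.2

/-! ### Top-degree coefficients of products -/

/-- The operator of a step. -/
noncomputable def stepOp (G : WeightedGraph V E) (R : Type w) [Ring R] (sp : V → E) (u : V) :
    Step E → Module.End R (List (Step E) →₀ R)
  | .real α i => G.realOp R sp u α i
  | .ghost α i => G.ghostOp R u α i

/-- The operator of a word. -/
noncomputable def listOp (G : WeightedGraph V E) (R : Type w) [Ring R] (sp : V → E) (u : V) :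
    List (Step E) → Module.End R (List (Step E) →₀ R)
  | [] => 1
  | l :: P => G.stepOp R sp u l * listOp G R sp u P

variable {R : Type w} [Ring R] {u v : V}

theorem listOp_append (P Q : List (Step E)) :
    G.listOp R sp u (P ++ Q) = G.listOp R sp u P * G.listOp R sp u Q := by
  induction P with
  | nil => simp [listOp]
  | cons l P ih => rw [List.cons_append, listOp, ih, listOp, mul_assoc]

theorem stepOp_of_not_reducible {w : List (Step E)} (hl : G.StepValid l)
    (hw : G.stepRng l = G.wordSrc u w) (h : ∀ l' ∈ w.head?, ¬ G.Reducible sp l l') :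
    G.stepOp R sp u l (Finsupp.single w 1) = Finsupp.single (l :: w) 1 := by
  cases l with
  | real α i => rw [stepOp, realOp_single, G.realAct_of_not_reducible hl hw h]
  | ghost α i => rw [stepOp, ghostOp_single, G.ghostAct_of_not_reducible hl hw h]

theorem IsNormal.of_append {P Q : List (Step E)} (h : G.IsNormal sp v (P ++ Q)) :
    G.IsNormal sp v Q := by
  induction P with
  | nil => exact h
  | cons l P ih => exact ih h.2.2.2

/-- After the pair at the junction has been rewritten, its new first letter is similar to the old
one, so rewriting does not propagate into `P`. Nothing is required of `z`, since only first pairs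
are rewritten. -/
theorem listOp_similar {P z : List (Step E)} (hP : G.IsNormal sp v (P ++ [l]))
    (h : G.Similar l m) :
    G.listOp R sp u P (Finsupp.single (m :: z) 1) = Finsupp.single (P ++ m :: z) 1 := by
  induction P with
  | nil => simp [listOp]
  | cons x P ih =>
    obtain ⟨h1, h2, h3, h4⟩ := hP
    rw [listOp, Module.End.mul_apply, ih h4]
    rcases P with _ | ⟨y, P⟩
    · refine stepOp_of_not_reducible h1 (h2.trans h.stepSrc_eq) ?_
      intro l' hl'
      simp at hl'; subst hl'
      exact fun hr => h3 l (by simp) (h.reducible hr)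
    · exact stepOp_of_not_reducible h1 h2 h3

theorem listOp_single_nil {P : List (Step E)} (hP : G.IsNormal sp u P) :
    G.listOp R sp u P (Finsupp.single [] 1) = Finsupp.single P 1 := by
  induction P with
  | nil => simp [listOp]
  | cons x P ih =>
    obtain ⟨h1, h2, h3, h4⟩ := hP
    rw [listOp, Module.End.mul_apply, ih h4]
    exact stepOp_of_not_reducible h1 h2 h3

variable (R E) in
/-- The span of the words of length at most `n`. -/
def lengthLE (n : ℕ) : Submodule R (List (Step E) →₀ R) :=
  Finsupp.supported R R {w | w.length ≤ n}

theorem lengthLE_mono {n k : ℕ} (h : n ≤ k) : lengthLE E R n ≤ lengthLE E R k :=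
  Finsupp.supported_mono fun _ hw => le_trans hw h

theorem single_mem_lengthLE {n : ℕ} {w : List (Step E)} (h : w.length ≤ n) (r : R) :
    Finsupp.single w r ∈ lengthLE E R n :=
  Finsupp.single_mem_supported R r h

theorem apply_eq_zero_of_mem_lengthLE {n : ℕ} {x : List (Step E) →₀ R}
    (hx : x ∈ lengthLE E R n) {W : List (Step E)} (hW : n < W.length) : x W = 0 := by
  by_contra h
  have : W.length ≤ n := hx (Finsupp.mem_support_iff.2 h)
  omega

/-- Rewriting replaces a pair by pairs or deletes it, so length never exceeds that of plain
concatenation. -/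
theorem stepOp_single_mem_lengthLE (l : Step E) (w : List (Step E)) :
    G.stepOp R sp u l (Finsupp.single w 1) ∈ lengthLE E R (w.length + 1) := by
  classical
  rcases l with ⟨α, i⟩ | ⟨α, i⟩
  · rw [stepOp, realOp_single]
    unfold realAct
    split_ifs
    · rcases w with _ | ⟨⟨β, j⟩ | ⟨β, j⟩, w⟩ <;> dsimp only
      · exact single_mem_lengthLE (by simp) 1
      · exact single_mem_lengthLE (by simp) 1
      · split_ifs
        · refine sub_mem (single_mem_lengthLE (by simp; omega) 1) (sum_mem fun γ _ => ?_)
          unfold realGhost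
          split_ifs
          · exact single_mem_lengthLE (by simp) 1
          · exact zero_mem _
        · refine sub_mem (zero_mem _) (sum_mem fun γ _ => ?_)
          unfold realGhost
          split_ifs
          · exact single_mem_lengthLE (by simp) 1
          · exact zero_mem _
        · exact single_mem_lengthLE (by simp) 1
    · exact zero_mem _
  · rw [stepOp, ghostOp_single]
    unfold ghostAct
    split_ifs
    · rcases w with _ | ⟨⟨β, j⟩ | ⟨β, j⟩, w⟩ <;> dsimp only
      · exact single_mem_lengthLE (by simp) 1
      · split_ifs
        · refine sub_mem (single_mem_lengthLE (by simp; omega) 1) (sum_mem fun γ _ => ?_)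
          unfold ghostReal
          split_ifs
          · exact single_mem_lengthLE (by simp) 1
          · exact zero_mem _
        · refine sub_mem (zero_mem _) (sum_mem fun γ _ => ?_)
          unfold ghostReal
          split_ifs
          · exact single_mem_lengthLE (by simp) 1
          · exact zero_mem _
        · exact single_mem_lengthLE (by simp) 1
      · exact single_mem_lengthLE (by simp) 1
    · exact zero_mem _

theorem stepOp_mem_lengthLE (l : Step E) {n : ℕ} {x : List (Step E) →₀ R}
    (hx : x ∈ lengthLE E R n) : G.stepOp R sp u l x ∈ lengthLE E R (n + 1) := by
  rw [lengthLE, Finsupp.supported_eq_span_single] at hx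
  induction hx using Submodule.span_induction with
  | mem x hx =>
    obtain ⟨w, hw, rfl⟩ := hx
    exact lengthLE_mono (Nat.succ_le_succ hw) (stepOp_single_mem_lengthLE l w)
  | zero => simp
  | add x y _ _ hx hy => rw [map_add]; exact add_mem hx hy
  | smul r x _ hx => rw [map_smul]; exact Submodule.smul_mem _ r hx

theorem listOp_mem_lengthLE (P : List (Step E)) {n : ℕ} {x : List (Step E) →₀ R}
    (hx : x ∈ lengthLE E R n) : G.listOp R sp u P x ∈ lengthLE E R (P.length + n) := by
  induction P with
  | nil => simpa [listOp] using hx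
  | cons l P ih =>
    rw [listOp, Module.End.mul_apply, List.length_cons, Nat.succ_add]
    exact stepOp_mem_lengthLE l ih

open Classical in
/-- The coefficients of the leading part of a reducible product. -/
theorem listOp_reducible_apply {P Q p q : List (Step E)} (hP : G.IsNormal sp v (P ++ [l]))
    (hQ : G.IsNormal sp u (l' :: Q)) (hv : G.stepSrc l' = v) (hr : G.Reducible sp l l')
    (hp : P.length = p.length) (hq : Q.length = q.length) :
    G.listOp R sp u P (G.stepOp R sp u l (Finsupp.single (l' :: Q) 1)) (p ++ a :: b :: q) =
      -(if G.Swap sp l l' a b ∧ P = p ∧ Q = q then 1 else 0) := by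
  obtain ⟨hl, hlv, -, -⟩ := hP.of_append
  -- The term in which the pair is deleted is two letters too short to contribute in top degree.
  have hlow : ∀ (c : Prop) [Decidable c], G.listOp R sp u P
      (if c then Finsupp.single Q 1 else 0) (p ++ a :: b :: q) = 0 := by
    intro c _
    split_ifs
    · exact apply_eq_zero_of_mem_lengthLE
        (listOp_mem_lengthLE P (single_mem_lengthLE le_rfl 1)) (by simp; omega)
    · simp
  have hinj : ∀ m m' : Step E, P ++ m :: m' :: Q = p ++ a :: b :: q ↔
      P = p ∧ m = a ∧ m' = b ∧ Q = q := by
    intro m m'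
    constructor
    · intro h
      obtain ⟨h1, h2⟩ := List.append_inj h hp
      simp at h2
      exact ⟨h1, h2⟩
    · rintro ⟨rfl, rfl, rfl, rfl⟩; rfl
  rcases l with ⟨α, i⟩ | ⟨α, i⟩ <;> rcases l' with ⟨β, j⟩ | ⟨β, j⟩
  · exact hr.elim
  · obtain ⟨rfl, hα⟩ := hr
    rw [stepOp, realOp_single, G.realAct_of_reducible j Q hl hα, map_sub, Finsupp.sub_apply, hlow,
      zero_sub, map_sum, Finsupp.finsetSum_apply]
    congr 1
    have hterm : ∀ γ ∈ (G.out (G.src α)).erase α,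
        G.listOp R sp u P (G.realGhost R γ i j Q) (p ++ a :: b :: q) =
        if (i < G.weight γ ∧ j < G.weight γ) ∧ P = p ∧ Step.real γ i = a ∧ Step.ghost γ j = b ∧
          Q = q then 1 else 0 := by
      intro γ hγ
      have hs := mem_out.1 (Finset.mem_erase.1 hγ).2
      unfold realGhost
      by_cases h : i < G.weight γ ∧ j < G.weight γ
      · rw [if_pos h, listOp_similar (m := Step.real γ i) (z := Step.ghost γ j :: Q) hP ⟨hs.symm, rfl⟩,
          Finsupp.single_apply]
        simp only [h, true_and, hinj]
      · simp [h]
    rw [Finset.sum_congr rfl hterm]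
    split_ifs with h
    · obtain ⟨h, rfl, rfl⟩ := h
      cases h with
      | real_ghost _ γ _ _ hc hs hne hi hj =>
      rw [Finset.sum_eq_single γ]
      · simp [hi, hj]
      · intro γ' _ hne'
        simp [hne']
      · intro h
        exact absurd (Finset.mem_erase.2 ⟨hne, mem_out.2 hs⟩) h
    · refine Finset.sum_eq_zero fun γ hγ => if_neg ?_
      rintro ⟨⟨hi, hj⟩, h1, rfl, rfl, h2⟩
      obtain ⟨hne, hs⟩ := Finset.mem_erase.1 hγ
      exact h ⟨.real_ghost α γ i j hα (mem_out.1 hs) hne hi hj, h1, h2⟩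
  · obtain ⟨rfl, rfl⟩ := hr
    have hs : G.src α = G.src β := hlv.trans hv.symm
    rw [stepOp, ghostOp_single, G.ghostAct_of_reducible Q hs, map_sub, Finsupp.sub_apply, hlow,
      zero_sub, map_sum, Finsupp.finsetSum_apply]
    congr 1
    have hterm : ∀ k ∈ Finset.Ico 1 (max (G.weight α) (G.weight β)),
        G.listOp R sp u P (G.ghostReal R α β k Q) (p ++ a :: b :: q) =
        if (k < G.weight α ∧ k < G.weight β) ∧ P = p ∧ Step.ghost α k = a ∧ Step.real β k = b ∧
          Q = q then 1 else 0 := by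
      intro k _
      unfold ghostReal
      by_cases h : k < G.weight α ∧ k < G.weight β
      · rw [if_pos h, listOp_similar (m := Step.ghost α k) (z := Step.real β k :: Q) hP
          (Eq.refl α), Finsupp.single_apply]
        simp only [h, true_and, hinj]
      · simp [h]
    rw [Finset.sum_congr rfl hterm]
    split_ifs with h
    · obtain ⟨h, rfl, rfl⟩ := h
      cases h with
      | ghost_real _ _ k hk hα hβ =>
      rw [Finset.sum_eq_single k]
      · simp [hα, hβ]
      · intro k' _ hne'
        simp [hne']
      · intro h
        exact absurd (Finset.mem_Ico.2 ⟨hk, lt_max_of_lt_left hα⟩) h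
    · refine Finset.sum_eq_zero fun k hk => if_neg ?_
      rintro ⟨⟨hα, hβ⟩, h1, rfl, rfl, h2⟩
      exact h ⟨.ghost_real α β k (Finset.mem_Ico.1 hk).1 hα hβ, h1, h2⟩
  · exact hr.elim

open Classical in
/-- The coefficients in top degree of a product of normal words. -/
theorem listOp_single_apply {P Q p q : List (Step E)} (hP : G.IsNormal sp v P)
    (hQ : G.IsNormal sp u Q) (hv : G.wordSrc u Q = v) (hp : P.length ≤ p.length + 1)
    (hq : Q.length ≤ q.length + 1) (hab : ¬ G.Reducible sp a b) :
    G.listOp R sp u P (Finsupp.single Q 1) (p ++ a :: b :: q) =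
      (if P = p ++ [a] ∧ Q = b :: q then 1 else 0) -
        (if ∃ l l', G.Swap sp l l' a b ∧ P = p ++ [l] ∧ Q = l' :: q then 1 else 0) := by
  by_cases hlen : P.length + Q.length < p.length + q.length + 2
  · rw [if_neg, if_neg, sub_zero]
    · exact apply_eq_zero_of_mem_lengthLE
        (listOp_mem_lengthLE P (single_mem_lengthLE le_rfl 1)) (by simp; omega)
    · rintro ⟨l, l', -, rfl, rfl⟩
      simp at hlen; omega
    · rintro ⟨rfl, rfl⟩
      simp at hlen; omega
  rcases List.eq_nil_or_concat P with rfl | ⟨P, l, rfl⟩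
  · simp at hlen; omega
  rcases Q with _ | ⟨l', Q⟩
  · simp at hlen hp; omega
  simp only [List.concat_eq_append, List.length_append, List.length_cons, List.length_nil] at *
  have hp' : P.length = p.length := by omega
  have hq' : Q.length = q.length := by omega
  obtain ⟨hl, hlv, -, -⟩ := hP.of_append
  have e1 : ∀ c : Step E, P ++ [l] = p ++ [c] ↔ P = p ∧ l = c := by
    intro c; simp
  rw [listOp_append, Module.End.mul_apply]
  have h1 : G.listOp R sp u [l] (Finsupp.single (l' :: Q) 1) =
      G.stepOp R sp u l (Finsupp.single (l' :: Q) 1) := by simp [listOp]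
  rw [h1]
  by_cases hr : G.Reducible sp l l'
  · rw [listOp_reducible_apply hP hQ hv hr hp' hq', if_neg (c := P ++ [l] = p ++ [a] ∧ _),
      zero_sub]
    · congr 1
      refine if_congr ?_ rfl rfl
      constructor
      · rintro ⟨h, rfl, rfl⟩
        exact ⟨l, l', h, rfl, rfl⟩
      · rintro ⟨c, c', h, h2, h3⟩
        rw [e1] at h2
        obtain ⟨rfl, rfl⟩ := h2
        simp at h3
        obtain ⟨rfl, rfl⟩ := h3
        exact ⟨h, rfl, rfl⟩
    · rintro ⟨h2, h3⟩
      rw [e1] at h2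
      obtain ⟨rfl, rfl⟩ := h2
      simp at h3
      obtain ⟨rfl, rfl⟩ := h3
      exact hab hr
  · rw [stepOp_of_not_reducible hl (hlv.trans hv.symm) (by simpa using hr),
      listOp_similar hP (.refl l), if_neg (c := ∃ _, _), sub_zero, Finsupp.single_apply]
    · refine if_congr ?_ rfl rfl
      rw [e1]
      constructor
      · intro h
        obtain ⟨h1, h2⟩ := List.append_inj h hp'
        simp at h2
        obtain ⟨rfl, rfl, rfl⟩ := h2
        exact ⟨⟨h1, rfl⟩, rfl⟩
      · rintro ⟨⟨rfl, rfl⟩, h2⟩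
        rw [h2]
    · rintro ⟨c, c', h, h2, h3⟩
      rw [e1] at h2
      obtain ⟨rfl, rfl⟩ := h2
      simp at h3
      obtain ⟨rfl, rfl⟩ := h3
      exact hr h.reducible

theorem rep_wordElt (P : List (Step E)) {x : List (Step E) →₀ R}
    (hx : x ∈ Finsupp.supported R R {w | G.wordSrc u w = v}) :
    G.rep R sp u (G.wordElt R v P) x = G.listOp R sp u P x := by
  induction P with
  | nil => rw [wordElt, rep_vtx, G.vertexOp_of_supported hx]; rfl
  | cons l P ih =>
    rw [wordElt, rep_mul_apply, ih, listOp, Module.End.mul_apply]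
    cases l
    · exact G.rep_edg sp u _ _ _
    · exact G.rep_gho sp u _ _ _

/-- Left linearity of the word operators keeps the scalars of `X` to the left of those of `Y`, as
needed over a noncommutative `R`. -/
theorem rep_wordSum_apply (X Y : List (Step E) →₀ R)
    (hY : Y ∈ Finsupp.supported R R {w | G.wordSrc u w = v}) (W : List (Step E)) :
    G.rep R sp u (G.wordSum R v X) Y W =
      ∑ P ∈ X.support, ∑ Q ∈ Y.support,
        X P * (Y Q * G.listOp R sp u P (Finsupp.single Q 1) W) := by
  rw [wordSum, Finsupp.linearCombination_apply, Finsupp.sum, rep_sum_apply,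
    Finsupp.finsetSum_apply]
  refine Finset.sum_congr rfl fun P _ => ?_
  rw [rep_smul, rep_wordElt P hY, Finsupp.smul_apply, smul_eq_mul, ← Finset.mul_sum]
  congr 1
  conv_lhs => rw [← Finsupp.sum_single Y, Finsupp.sum, map_sum, Finsupp.finsetSum_apply]
  refine Finset.sum_congr rfl fun Q _ => ?_
  rw [← mul_one (Y Q), ← smul_eq_mul (Y Q) 1, ← Finsupp.smul_single, map_smul, Finsupp.smul_apply]
  simp

theorem sum_sum_mul_ite {ι : Type*} [DecidableEq ι] (X Y : ι →₀ R) (P Q : ι) :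
    ∑ p ∈ X.support, ∑ q ∈ Y.support, X p * (Y q * if p = P ∧ q = Q then 1 else 0) =
      X P * Y Q := by
  rw [Finset.sum_eq_single P, Finset.sum_eq_single Q]
  · simp
  · intro q _ h; simp [h]
  · intro h; simp [Finsupp.notMem_support_iff.1 h]
  · intro p _ h; simp [h]
  · intro h; simp [Finsupp.notMem_support_iff.1 h]

theorem exists_max_length {X : List (Step E) →₀ R} (hX : X ≠ 0) :
    ∃ p ∈ X.support, ∀ P ∈ X.support, P.length ≤ p.length :=
  Finset.exists_max_image _ _ (Finsupp.support_nonempty_iff.2 hX)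

/-- Products of nonzero combinations of normal words at a common vertex are nonzero. -/
theorem rep_wordSum_ne_zero [NoZeroDivisors R] (hG : G.IsLV) (hsp : G.IsSelector sp)
    {X Y : List (Step E) →₀ R} (hX : X ∈ G.normalSpan R sp v) (hY : Y ∈ G.normalSpan R sp u)
    (hv : Y ∈ Finsupp.supported R R {w | G.wordSrc u w = v}) (hX0 : X ≠ 0) (hY0 : Y ≠ 0) :
    G.rep R sp u (G.wordSum R v X) Y ≠ 0 := by
  classical
  intro hZ
  obtain ⟨p, hp, hpmax⟩ := exists_max_length hX0
  obtain ⟨q, hq, hqmax⟩ := exists_max_length hY0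
  have hp0 := Finsupp.mem_support_iff.1 hp
  have hq0 := Finsupp.mem_support_iff.1 hq
  have hsum : ∀ W, ∑ P ∈ X.support, ∑ Q ∈ Y.support,
      X P * (Y Q * G.listOp R sp u P (Finsupp.single Q 1) W) = 0 := fun W => by
    rw [← rep_wordSum_apply X Y hv, hZ]; rfl
  have direct : ∀ (P₁ Q₁ W : List (Step E)), (∀ P ∈ X.support, ∀ Q ∈ Y.support,
      G.listOp R sp u P (Finsupp.single Q 1) W = if P = P₁ ∧ Q = Q₁ then 1 else 0) →
      X P₁ * Y Q₁ = 0 := by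
    intro P₁ Q₁ W h
    refine ((sum_sum_mul_ite X Y P₁ Q₁).symm.trans ?_).trans (hsum W)
    exact Finset.sum_congr rfl fun P hP => Finset.sum_congr rfl fun Q hQ => by rw [h P hP Q hQ]
  rcases List.eq_nil_or_concat p with rfl | ⟨p, a, rfl⟩
  -- Here `X` is supported on the empty word and acts on `Y` as a nonzero scalar.
  · refine mul_ne_zero hp0 hq0 (direct [] q q fun P hP Q _ => ?_)
    have : P = [] := List.eq_nil_of_length_eq_zero (Nat.le_zero.1 (hpmax P hP))
    subst this
    simp [listOp, Finsupp.single_apply]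
  rw [List.concat_eq_append] at hp hp0 hpmax
  rcases q with _ | ⟨b, q⟩
  · refine mul_ne_zero hp0 hq0 (direct _ [] (p ++ [a]) fun P hP Q hQ => ?_)
    have : Q = [] := List.eq_nil_of_length_eq_zero (Nat.le_zero.1 (hqmax Q hQ))
    subst this
    -- The empty word ending in `u` has source `u`, while words in `Y` have source `v`.
    have huv : u = v := hv hQ
    subst huv
    rw [listOp_single_nil (hX hP)]
    simp [Finsupp.single_apply]
  have hp1 : ∀ P ∈ X.support, P.length ≤ p.length + 1 := fun P hP => by
    simpa using hpmax P hP
  have hq1 : ∀ Q ∈ Y.support, Q.length ≤ q.length + 1 := fun Q hQ => by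
    simpa using hqmax Q hQ
  have top_direct : ∀ a b, ¬ G.Reducible sp a b → (∀ l l', ¬ G.Swap sp l l' a b) →
      X (p ++ [a]) * Y (b :: q) = 0 := by
    intro a b hr hs
    refine direct _ _ (p ++ a :: b :: q) fun P hP Q hQ => ?_
    rw [listOp_single_apply (hX hP) (hY hQ) (hv hQ) (hp1 P hP) (hq1 Q hQ) hr,
      if_neg (c := ∃ _, _), sub_zero]
    rintro ⟨l, l', h, -⟩
    exact hs l l' h
  -- The coefficient of `pabq` in the product, assumed zero, is the difference of the two sides.
  have top_swap : ∀ l l' a b, G.Swap sp l l' a b →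
      X (p ++ [a]) * Y (b :: q) = X (p ++ [l]) * Y (l' :: q) := by
    intro l l' a b h
    rw [← sub_eq_zero, ← sum_sum_mul_ite X Y, ← sum_sum_mul_ite X Y, ← Finset.sum_sub_distrib]
    refine Eq.trans ?_ (hsum (p ++ a :: b :: q))
    refine Finset.sum_congr rfl fun P hP => ?_
    rw [← Finset.sum_sub_distrib]
    refine Finset.sum_congr rfl fun Q hQ => ?_
    rw [listOp_single_apply (hX hP) (hY hQ) (hv hQ) (hp1 P hP) (hq1 Q hQ) h.not_reducible,
      ← mul_sub, ← mul_sub]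
    congr 3
    refine if_congr ?_ rfl rfl
    constructor
    · rintro ⟨h1, h2⟩; exact ⟨l, l', h, h1, h2⟩
    · rintro ⟨c, c', h', h1, h2⟩
      obtain ⟨rfl, rfl⟩ := h.unique h'
      exact ⟨h1, h2⟩
  have hab := mul_ne_zero hp0 hq0
  -- In the first two cases transport along `top_swap` makes the coefficient of `X` at a new last
  -- letter nonzero; paired with the old `b` this letter forms a mixed pair, to which `top_direct`
  -- applies.
  by_cases hr : G.Reducible sp a b
  · obtain ⟨c, c', h⟩ := hG.exists_swap hsp hr
      (IsNormal.of_append (P := p) (hX hp)).1 (hY hq).1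
    rw [← top_swap _ _ _ _ h] at hab
    exact mul_ne_zero (left_ne_zero_of_mul hab) hq0
      (top_direct c b h.not_reducible_right fun _ _ => h.not_swap_right)
  · by_cases hs : ∃ l l', G.Swap sp l l' a b
    · obtain ⟨l, l', h⟩ := hs
      rw [top_swap _ _ _ _ h] at hab
      exact mul_ne_zero (left_ne_zero_of_mul hab) hq0
        (top_direct l b h.not_reducible_left fun _ _ => h.not_swap_left)
    · push Not at hs
      exact hab (top_direct a b hr hs)

end LeadingTerms

/-! ### Local absence of zero divisors and nonsingularity -/

section Main

variable {R : Type w} [Ring R]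

theorem exists_isSelector [Nonempty E] : ∃ sp, G.IsSelector sp := by
  classical
  have h : ∀ x, ∃ α, (G.out x).Nonempty → G.src α = x ∧ G.weight α = G.maxWeight x := by
    intro x
    by_cases hx : (G.out x).Nonempty
    · obtain ⟨α, hα, h⟩ := Finset.exists_mem_eq_sup _ hx G.weight
      exact ⟨α, fun _ => ⟨mem_out.1 hα, h.symm⟩⟩
    · exact ⟨Classical.arbitrary E, fun h => absurd h hx⟩
  choose sp hsp using h
  exact ⟨sp, hsp⟩

theorem supported_of_vertexOp_eq {u v : V} {x : List (Step E) →₀ R}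
    (hx : G.vertexOp R u v x = x) : x ∈ Finsupp.supported R R {w | G.wordSrc u w = v} := by
  rw [← hx, vertexOp, Finsupp.linearCombination_apply]
  refine sum_mem fun w _ => Submodule.smul_mem _ _ ?_
  unfold vertexAct
  split_ifs with h
  · exact Finsupp.single_mem_supported R 1 h
  · exact zero_mem _

/-- Weighted Leavitt path algebras of LV-graphs over domains have no zero divisors locally. -/
theorem IsLV.mul_ne_zero [NoZeroDivisors R] (hG : G.IsLV) {x y : G.LeavittPathAlgebra R} {v : V}
    (hx : x * G.toLeavitt R (G.vtx R v) = x) (hy : G.toLeavitt R (G.vtx R v) * y = y)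
    (hx0 : x ≠ 0) (hy0 : y ≠ 0) : x * y ≠ 0 := by
  have := hG.nonempty
  obtain ⟨sp, hsp⟩ := G.exists_isSelector
  -- Normal words have a fixed end, so `y` is first cut down to a nonzero `yu`.
  obtain ⟨u, hu⟩ := G.exists_mul_vtx_ne_zero hy0
  obtain ⟨a, rfl⟩ := G.toLeavitt_surjective x
  obtain ⟨b, rfl⟩ := G.toLeavitt_surjective y
  have hnil : ∀ v, (Finsupp.single [] 1 : List (Step E) →₀ R) ∈ G.normalSpan R sp v := fun v =>
    G.single_mem_normalSpan (w := []) trivial 1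
  have hsumnil : ∀ v, G.wordSum R v (Finsupp.single [] 1) = G.vtx R v := fun v => by
    rw [wordSum_single, one_smul, wordElt]
  have hrep : ∀ c d : G.FreeRing R, G.toLeavitt R c = G.toLeavitt R d →
      ∀ m ∈ G.normalSpan R sp u, G.rep R sp u c m = G.rep R sp u d m := by
    intro c d h m hm
    rw [toLeavitt_eq_iff] at h
    have := G.rep_eq_zero_of_mem hsp h hm
    rw [map_sub] at this
    exact sub_eq_zero.1 this
  have hX : G.toLeavitt R (G.wordSum R v (G.rep R sp v a (Finsupp.single [] 1))) =
      G.toLeavitt R a := by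
    rw [← G.toLeavitt_mul_wordSum hsp a (hnil v), hsumnil, map_mul, hx]
  have hY : G.toLeavitt R (G.wordSum R u (G.rep R sp u b (Finsupp.single [] 1))) =
      G.toLeavitt R b * G.toLeavitt R (G.vtx R u) := by
    rw [← G.toLeavitt_mul_wordSum hsp b (hnil u), hsumnil, map_mul]
  set X := G.rep R sp v a (Finsupp.single [] 1) with hXdef
  set Y := G.rep R sp u b (Finsupp.single [] 1) with hYdef
  have hYv : G.vertexOp R u v Y = Y := by
    rw [← G.rep_vtx sp, hYdef, ← rep_mul_apply]
    exact hrep _ _ (by rw [map_mul, hy]) _ (hnil u)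
  intro h0
  refine rep_wordSum_ne_zero hG hsp (G.rep_mem a (hnil v)) (G.rep_mem b (hnil u))
    (G.supported_of_vertexOp_eq hYv) (X := X) (Y := Y) ?_ ?_ ?_
  · intro h
    rw [h, map_zero, map_zero] at hX
    exact hx0 hX.symm
  · intro h
    rw [h, map_zero, map_zero] at hY
    exact hu hY.symm
  -- The product applied to the empty word is the action of an element representing `xy = 0`.
  · rw [hYdef, ← rep_mul_apply]
    have : G.toLeavitt R (G.wordSum R v X * b) = G.toLeavitt R 0 := by
      rw [map_mul, hX, h0, map_zero]
    rw [hrep _ _ this _ (hnil u), map_zero]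
    rfl

theorem IsLV.isRightNonsingular [NoZeroDivisors R] (hG : G.IsLV) :
    IsRightNonsingular (G.LeavittPathAlgebra R) := by
  classical
  intro a ha
  by_contra ha0
  obtain ⟨v, hv⟩ := G.exists_mul_vtx_ne_zero ha0
  have hvv := G.toLeavitt_vtx_mul_vtx (R := R) v v
  rw [if_pos rfl] at hvv
  set e := G.toLeavitt R (G.vtx R v)
  -- The right ideal `vA` is the one missed by the annihilator; it contains the idempotent `v`,
  -- which is nonzero because `av ≠ 0`.
  refine ha.2 (AddMonoidHom.mulLeft e).range ?_ ?_ ?_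
  · rintro _ ⟨b, rfl⟩ c
    exact ⟨b * c, (mul_assoc e b c).symm⟩
  · intro h
    have he : e ∈ (AddMonoidHom.mulLeft e).range := ⟨e, hvv⟩
    rw [h, AddSubgroup.mem_bot] at he
    exact hv (by rw [he, mul_zero])
  · rw [eq_bot_iff]
    rintro _ ⟨hb, b, rfl⟩
    rw [AddSubgroup.mem_bot]
    by_contra hb0
    refine hG.mul_ne_zero G (v := v) (x := a * e) ?_ ?_ hv hb0 ?_
    · rw [mul_assoc, hvv]
    · exact (mul_assoc e e b).symm.trans (by rw [hvv]; rfl)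
    · have hb' : a * (e * b) = 0 := hb
      change a * e * (e * b) = 0
      rw [mul_assoc, ← mul_assoc e, hvv, hb']

theorem IsLV.isLeftNonsingular [NoZeroDivisors R] (hG : G.IsLV) :
    IsLeftNonsingular (G.LeavittPathAlgebra R) := by
  classical
  intro a ha
  by_contra ha0
  obtain ⟨v, hv⟩ := G.exists_vtx_mul_ne_zero ha0
  have hvv := G.toLeavitt_vtx_mul_vtx (R := R) v v
  rw [if_pos rfl] at hvv
  set e := G.toLeavitt R (G.vtx R v)
  refine ha.2 (AddMonoidHom.mulRight e).range ?_ ?_ ?_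
  · rintro _ ⟨b, rfl⟩ c
    exact ⟨c * b, mul_assoc c b e⟩
  · intro h
    have he : e ∈ (AddMonoidHom.mulRight e).range := ⟨e, hvv⟩
    rw [h, AddSubgroup.mem_bot] at he
    exact hv (by rw [he, zero_mul])
  · rw [eq_bot_iff]
    rintro _ ⟨hb, b, rfl⟩
    rw [AddSubgroup.mem_bot]
    by_contra hb0
    refine hG.mul_ne_zero G (v := v) (y := e * a) ?_ ?_ hb0 hv ?_
    · exact (mul_assoc b e e).trans (by rw [hvv]; rfl)
    · rw [← mul_assoc, hvv]
    · have hb' : b * e * a = 0 := hb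
      change b * e * (e * a) = 0
      rw [mul_assoc, ← mul_assoc e, hvv, ← mul_assoc, hb']

end Main

end WeightedGraph

theorem mainTheorem11 {V E R : Type*} [Countable V] [Countable E] [Ring R] [IsDomain R]
    (G : WeightedGraph V E) (hG : G.IsLV) :
    IsLeftNonsingular (G.LeavittPathAlgebra R) ∧ IsRightNonsingular (G.LeavittPathAlgebra R) := by
  exact ⟨hG.isLeftNonsingular G, hG.isRightNonsingular G⟩
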